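/- Let $X$ be a compact Kähler threefold, with complex structure $J$, Kähler form $\omega$ and Riemannian metric $\langle u,v\rangle=\omega(u,Jv)$, and let $\alpha$ be a holomorphic $2$-form on $X$ that is not identically zero. Let $Z_\alpha=\{x\in X:\alpha_x=0\}$, and let $K_\alpha$ be the endomorphism of the real tangent bundle $TX$ defined by $\langle u,K_\alpha v\rangle=\mathrm{Re}\,\alpha(u,v)$ for all $u,v$. A foliation of dimension $m$ and codimension $k$ of an open set $M\subset X$ is a decomposition of $M$ into pairwise disjoint connected subsets (leaves) such that each point of $M$ lies in the domain $U\subset M$ of a foliation chart, i.e. a diffeomorphism $\varphi:U\to W_1\times W_2$ onto a product of open disks in $\mathbb R^m$ and $\mathbb R^{k}$ such that for each $q\in W_2$ the plaque $\varphi^{-1}(W_1\times\{q\})$ is a connected component of $U\cap L$ for some leaf $L$. It is induced by $\ker K_\alpha$ if around each point of $M$ there is a foliation chart whose plaques have tangent space $\ker K_\alpha$ at each of their points. Then $\ker K_\alpha$ induces a foliation of (real) dimension two and codimension four of $X\setminus Z_\alpha$, and for every such foliation $\mathcal F_\alpha$ the following holds. Let $C$ be a connected compact nodal curve with finitely many marked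 points, and let $f:C\to X$ be a non-constant stable holomorphic map (stable: the group of automorphisms of the marked curve $C$ that are compatible with $f$ is finite) with $K_\alpha\,df=0$. Then for each irreducible component $C_i$ of $C$, either $f(C_i)\subset Z_\alpha$, or there are a leaf $L$ of $\mathcal F_\alpha$ and a finite subset $S$ of $Z_\alpha$ with $f(C_i)\subset L\cup S$. Consequently, if $\alpha$ has no zeros, then $f(C)$ lies in one leaf of the foliation $\mathcal F_\alpha$ of $X$. -/

import Mathlib

open scoped Manifold ContDiff

noncomputable section

/-! ### Linear algebra on a complex vector space -/

section LinearAlgebra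

theorem update_vec2_zero {V : Type*} (u v y : V) : Function.update ![u, v] 0 y = ![y, v] := by
  ext i; fin_cases i <;> rfl

theorem update_vec2_one {V : Type*} (u v y : V) : Function.update ![u, v] 1 y = ![u, y] := by
  ext i; fin_cases i <;> rfl

variable {V : Type*} [NormedAddCommGroup V] [NormedSpace ℂ V]

/-- The real part of a complex alternating 2-form, as a real bilinear form. -/
def reBilin (a : V [⋀^Fin 2]→L[ℂ] ℂ) : LinearMap.BilinForm ℝ V :=
  LinearMap.mk₂ ℝ (fun u v => (a ![u, v]).re)
    (fun u u' v => by
      have h := a.map_update_add ![u, v] 0 u u'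
      simp only [update_vec2_zero] at h
      rw [h, Complex.add_re])
    (fun c u v => by
      have h := a.map_update_smul ![u, v] 0 (c : ℂ) u
      simp only [update_vec2_zero, Complex.coe_smul] at h
      simp [h])
    (fun u v v' => by
      have h := a.map_update_add ![u, v] 1 v v'
      simp only [update_vec2_one] at h
      rw [h, Complex.add_re])
    (fun c u v => by
      have h := a.map_update_smul ![u, v] 1 (c : ℂ) v
      simp only [update_vec2_one, Complex.coe_smul] at h
      simp [h])

/-- The real bilinear form `(u, v) ↦ w(u, i v)` attached to a real alternating 2-form `w`. -/
def metricBilin (w : V [⋀^Fin 2]→L[ℝ] ℝ) : LinearMap.BilinForm ℝ V :=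
  LinearMap.mk₂ ℝ (fun u v => w ![u, Complex.I • v])
    (fun u u' v => by
      have h := w.map_update_add ![u, Complex.I • v] 0 u u'
      simpa only [update_vec2_zero] using h)
    (fun c u v => by
      have h := w.map_update_smul ![u, Complex.I • v] 0 c u
      simpa only [update_vec2_zero] using h)
    (fun u v v' => by
      have h := w.map_update_add ![u, v] 1 (Complex.I • v) (Complex.I • v')
      simpa only [update_vec2_one, smul_add] using h)
    (fun c u v => by
      have h := w.map_update_smul ![u, v] 1 c (Complex.I • v)
      simpa only [update_vec2_one, smul_comm Complex.I c v] using h)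

theorem metricBilin_symm (w : V [⋀^Fin 2]→L[ℝ] ℝ)
    (hw : ∀ u v : V, w ![Complex.I • u, Complex.I • v] = w ![u, v]) (u v : V) :
    metricBilin w u v = metricBilin w v u := by
  have h1 := hw u (Complex.I • v)
  rw [smul_smul, Complex.I_mul_I, neg_one_smul] at h1
  have h2 : w ![v, Complex.I • u] = - w ![Complex.I • u, v] := by
    have h3 : (![Complex.I • u, v] ∘ (Equiv.swap (0 : Fin 2) 1)) = ![v, Complex.I • u] := by
      ext i; fin_cases i <;> simp
    rw [← h3]
    exact w.toAlternatingMap.map_swap ![Complex.I • u, v] (by decide)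
  have h4 := w.map_update_smul ![Complex.I • u, v] 1 (-1 : ℝ) v
  simp only [update_vec2_one, neg_one_smul] at h4
  change w ![u, Complex.I • v] = w ![v, Complex.I • u]
  rw [← h1, h4, h2]

theorem metricBilin_nondegenerate (w : V [⋀^Fin 2]→L[ℝ] ℝ)
    (hw : ∀ u : V, u ≠ 0 → 0 < w ![u, Complex.I • u]) : (metricBilin w).Nondegenerate := by
  constructor
  · intro u hu
    by_contra h
    exact (hw u h).ne' (hu u)
  · intro u hu
    by_contra h
    exact (hw u h).ne' (hu u)

end LinearAlgebra

/-! ### Differential forms on manifolds, read in charts -/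

section Forms

variable {𝕜 : Type*} [NontriviallyNormedField 𝕜]
  {E : Type*} [NormedAddCommGroup E] [NormedSpace 𝕜 E]
  {X : Type*} [TopologicalSpace X] [ChartedSpace E X]

/-- The expression of an `n`-form `η` on the manifold `X` in the chart `e`: the pull-back of `η`
under the inverse of `e`. It is meaningful on `e.target`. -/
def chartForm {n : ℕ} (η : ∀ x : X, TangentSpace 𝓘(𝕜, E) x [⋀^Fin n]→L[𝕜] 𝕜)
    (e : OpenPartialHomeomorph X E) : E → E [⋀^Fin n]→L[𝕜] 𝕜 :=
  fun z => (η (e.symm z)).compContinuousLinearMap (mfderiv 𝓘(𝕜, E) 𝓘(𝕜, E) e.symm z)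

end Forms

/-! ### Kähler forms, holomorphic 2-forms and the endomorphism `K_α` -/

section Kaehler

variable (E : Type*) [NormedAddCommGroup E] [NormedSpace ℂ E]
  (X : Type*) [TopologicalSpace X] [ChartedSpace E X]

variable {E X} in
/-- The complex structure `J` of a complex manifold, on the real tangent space at `x`:
multiplication by `i` in a holomorphic chart. -/
def complexStructure (x : X) : TangentSpace 𝓘(ℝ, E) x →L[ℝ] TangentSpace 𝓘(ℝ, E) x :=
  (Complex.I • ContinuousLinearMap.id ℂ E).restrictScalars ℝ

/-- A Kähler form on a complex manifold: a smooth closed real 2-form `w` that is invariant under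
`J` and positive, so that `⟨u, v⟩ = w(u, J v)` is a Riemannian metric. -/
structure KaehlerForm where
  /-- The underlying real 2-form. -/
  form : ∀ x : X, TangentSpace 𝓘(ℝ, E) x [⋀^Fin 2]→L[ℝ] ℝ
  smooth : ∀ e ∈ atlas E X, ContDiffOn ℝ ∞ (chartForm form e) e.target
  closed : ∀ e ∈ atlas E X, ∀ z ∈ e.target, extDeriv (chartForm form e) z = 0
  invariant : ∀ (x : X) (u v : TangentSpace 𝓘(ℝ, E) x),
    form x ![complexStructure x u, complexStructure x v] = form x ![u, v]
  positive : ∀ (x : X) (u : TangentSpace 𝓘(ℝ, E) x), u ≠ 0 →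
    0 < form x ![u, complexStructure x u]

/-- A holomorphic 2-form on a complex manifold. -/
structure HolomorphicTwoForm where
  /-- The underlying complex alternating bilinear form on each tangent space. -/
  form : ∀ x : X, TangentSpace 𝓘(ℂ, E) x [⋀^Fin 2]→L[ℂ] ℂ
  holomorphic : ∀ e ∈ atlas E X, DifferentiableOn ℂ (chartForm form e) e.target

variable {E X}

/-- The zero locus `Z_α` of a holomorphic 2-form. -/
def HolomorphicTwoForm.zeroLocus (α : HolomorphicTwoForm E X) : Set X := {x | α.form x = 0}

/-- The real bilinear form `(Re α)(u, v)` on the real tangent space at `x`. -/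
def HolomorphicTwoForm.re (α : HolomorphicTwoForm E X) (x : X) :
    LinearMap.BilinForm ℝ (TangentSpace 𝓘(ℝ, E) x) :=
  reBilin (V := E) (α.form x)

/-- The Riemannian metric `⟨u, v⟩ = w(u, J v)` of a Kähler form `w`. -/
def KaehlerForm.metric (w : KaehlerForm E X) (x : X) :
    LinearMap.BilinForm ℝ (TangentSpace 𝓘(ℝ, E) x) :=
  metricBilin (V := E) (w.form x)

theorem KaehlerForm.metric_apply (w : KaehlerForm E X) (x : X)
    (u v : TangentSpace 𝓘(ℝ, E) x) :
    w.metric x u v = w.form x ![u, complexStructure x v] := rfl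

theorem KaehlerForm.metric_symm (w : KaehlerForm E X) (x : X)
    (u v : TangentSpace 𝓘(ℝ, E) x) : w.metric x u v = w.metric x v u :=
  metricBilin_symm (V := E) (w.form x) (w.invariant x) u v

theorem KaehlerForm.metric_nondegenerate (w : KaehlerForm E X) (x : X) :
    (w.metric x).Nondegenerate :=
  metricBilin_nondegenerate (V := E) (w.form x) (w.positive x)

instance tangentSpace_finiteDimensional_real [FiniteDimensional ℂ E] (x : X) :
    FiniteDimensional ℝ (TangentSpace 𝓘(ℝ, E) x) :=
  inferInstanceAs (FiniteDimensional ℝ E)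

/-- The endomorphism `K_α` of the real tangent space at `x`, defined by
`⟨u, K_α v⟩ = (Re α)(u, v)` for all `u`. -/
def kEndo [FiniteDimensional ℂ E] (w : KaehlerForm E X) (α : HolomorphicTwoForm E X) (x : X) :
    TangentSpace 𝓘(ℝ, E) x →ₗ[ℝ] TangentSpace 𝓘(ℝ, E) x :=
  ((w.metric x).toDual (w.metric_nondegenerate x)).symm.toLinearMap ∘ₗ (α.re x).flip

theorem metric_kEndo [FiniteDimensional ℂ E] (w : KaehlerForm E X) (α : HolomorphicTwoForm E X)
    (x : X) (u v : TangentSpace 𝓘(ℝ, E) x) :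
    w.metric x u (kEndo w α x v) = (α.form x ![u, v]).re := by
  rw [w.metric_symm]
  exact LinearMap.BilinForm.apply_toDual_symm_apply
    (hB := w.metric_nondegenerate x) _ _

end Kaehler

/-! ### Foliations -/

section Foliation

variable {E : Type*} [NormedAddCommGroup E] [NormedSpace ℝ E]
  {X : Type*} [TopologicalSpace X] [ChartedSpace E X]

/-- `φ : U → W₁ × W₂` is a (smooth) foliation chart for the decomposition `F` of the open subset
`M` of `X` into leaves of dimension `m` and codimension `k`: `U ⊆ M` is open, `W₁` and `W₂` are
open disks in `ℝᵐ` and `ℝᵏ`, `φ` is a diffeomorphism, and for each `q ∈ W₂` the plaque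
`φ⁻¹(W₁ × {q})` is a connected component of `U ∩ L` for some leaf `L`. -/
structure IsFoliationChart (m k : ℕ) (M : Set X) (F : Set (Set X))
    (φ : OpenPartialHomeomorph X (EuclideanSpace ℝ (Fin m) × EuclideanSpace ℝ (Fin k))) :
    Prop where
  source_subset : φ.source ⊆ M
  contMDiffOn : ContMDiffOn 𝓘(ℝ, E)
    𝓘(ℝ, EuclideanSpace ℝ (Fin m) × EuclideanSpace ℝ (Fin k)) ∞ φ φ.source
  contMDiffOn_symm : ContMDiffOn 𝓘(ℝ, EuclideanSpace ℝ (Fin m) × EuclideanSpace ℝ (Fin k))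
    𝓘(ℝ, E) ∞ φ.symm φ.target
  plaques : ∃ (a : EuclideanSpace ℝ (Fin m)) (b : EuclideanSpace ℝ (Fin k)) (r s : ℝ),
    φ.target = Metric.ball a r ×ˢ Metric.ball b s ∧
    ∀ q ∈ Metric.ball b s, ∃ L ∈ F, ∃ x ∈ φ.source ∩ L,
      φ.symm '' (Metric.ball a r ×ˢ {q}) = connectedComponentIn (φ.source ∩ L) x

variable (E) in
/-- `F` (the set of leaves) is a foliation of dimension `m` and codimension `k` of the open subset
`M` of `X`: a decomposition of `M` into pairwise disjoint connected subsets, such that every point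
of `M` lies in the domain of a foliation chart. -/
structure IsFoliation (m k : ℕ) (M : Set X) (F : Set (Set X)) : Prop where
  isConnected : ∀ L ∈ F, IsConnected L
  sUnion_eq : ⋃₀ F = M
  pairwiseDisjoint : F.PairwiseDisjoint id
  exists_chart : ∀ p ∈ M, ∃ φ : OpenPartialHomeomorph X
    (EuclideanSpace ℝ (Fin m) × EuclideanSpace ℝ (Fin k)),
    p ∈ φ.source ∧ IsFoliationChart (E := E) m k M F φ

/-- `F` is a foliation of `M` given by the distribution `D`: a foliation such that at each point
of `M` the tangent space of the leaf, i.e. the tangent space of the plaque `pr₂ ∘ φ = const` of a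
foliation chart `φ`, is the subspace `D x`. -/
structure IsFoliationOf (m k : ℕ) (M : Set X)
    (D : ∀ x : X, Submodule ℝ (TangentSpace 𝓘(ℝ, E) x)) (F : Set (Set X)) : Prop
    extends IsFoliation E m k M F where
  tangent : ∀ p ∈ M, ∃ φ : OpenPartialHomeomorph X
    (EuclideanSpace ℝ (Fin m) × EuclideanSpace ℝ (Fin k)),
    p ∈ φ.source ∧ IsFoliationChart (E := E) m k M F φ ∧
    ∀ x ∈ φ.source, ∀ v : TangentSpace 𝓘(ℝ, E) x,
      v ∈ D x ↔ mfderiv 𝓘(ℝ, E) 𝓘(ℝ, EuclideanSpace ℝ (Fin k)) (fun y => (φ y).2) x v = 0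

end Foliation

/-! ### Marked nodal curves and stable maps -/

/-- A marked nodal curve with `n` marked points, presented by its normalization `N` (a Riemann
surface, possibly disconnected): finitely many pairs of distinct points of `N`, no two of them
with a common point, are glued to nodes; the marked points are distinct and are not nodes. -/
structure NodalCurve (N : Type*) (n : ℕ) where
  /-- The pairs of points of the normalization that are glued to nodes. -/
  nodes : Set (Sym2 N)
  finite_nodes : nodes.Finite
  not_isDiag : ∀ s ∈ nodes, ¬ s.IsDiag
  eq_of_mem : ∀ s ∈ nodes, ∀ t ∈ nodes, ∀ p : N, p ∈ s → p ∈ t → s = t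
  /-- The marked points. -/
  mark : Fin n → N
  mark_injective : Function.Injective mark
  mark_notMem : ∀ i, ∀ s ∈ nodes, mark i ∉ s

namespace NodalCurve

variable {N : Type*} {n : ℕ}

/-- Two points of the normalization are identified if they are equal or form a node. -/
def setoid (C : NodalCurve N n) : Setoid N where
  r p q := p = q ∨ s(p, q) ∈ C.nodes
  iseqv := by
    refine ⟨fun p => Or.inl rfl, ?_, ?_⟩
    · rintro p q (rfl | h)
      · exact Or.inl rfl
      · exact Or.inr (by rwa [Sym2.eq_swap])
    · rintro p q r (rfl | h) (rfl | h')
      · exact Or.inl rfl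
      · exact Or.inr h'
      · exact Or.inr h
      · have := C.eq_of_mem _ h _ h' q (by simp) (by simp)
        rw [Sym2.eq_swap, Sym2.congr_right] at this
        exact Or.inl this

/-- The nodal curve itself (as a set of points): the normalization with the points of each node
identified. -/
def Curve (C : NodalCurve N n) : Type _ := Quotient C.setoid

/-- The normalization map. -/
def proj (C : NodalCurve N n) : N → C.Curve := Quotient.mk C.setoid

variable [TopologicalSpace N]

/-- The quotient topology. -/
instance (C : NodalCurve N n) : TopologicalSpace C.Curve :=
  inferInstanceAs (TopologicalSpace (Quotient C.setoid))

/-- The irreducible components of a nodal curve: the images of the connected components of its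
normalization. -/
def irreducibleComponents (C : NodalCurve N n) : Set (Set C.Curve) :=
  Set.range fun p : N => C.proj '' connectedComponent p

variable [ChartedSpace ℂ N]
  {E : Type*} [NormedAddCommGroup E] [NormedSpace ℂ E]
  {X : Type*} [TopologicalSpace X] [ChartedSpace E X]

variable (E) in
/-- A map from a nodal curve to a complex manifold is holomorphic if it is so on the
normalization. -/
def IsHolomorphic (C : NodalCurve N n) (f : C.Curve → X) : Prop :=
  ContMDiff 𝓘(ℂ, ℂ) 𝓘(ℂ, E) ω (f ∘ C.proj)

/-- The automorphisms of a map `f` from a marked nodal curve: the automorphisms of the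
curve (i.e. the biholomorphic maps of the normalization that preserve the nodes) that fix the
marked points and are compatible with `f`. -/
def Automorphism (C : NodalCurve N n) (f : C.Curve → X) : Type _ :=
  {Φ : Diffeomorph 𝓘(ℂ, ℂ) 𝓘(ℂ, ℂ) N N ω //
    (∀ p q : N, s(Φ p, Φ q) ∈ C.nodes ↔ s(p, q) ∈ C.nodes) ∧
    (∀ i, Φ (C.mark i) = C.mark i) ∧ ∀ p : N, f (C.proj (Φ p)) = f (C.proj p)}

variable (E) in
/-- `f : C → X` is a stable holomorphic map from a connected marked nodal curve: it is
holomorphic and its automorphism group is finite. -/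
structure IsStableMap (C : NodalCurve N n) (f : C.Curve → X) : Prop where
  connected : ConnectedSpace C.Curve
  holomorphic : C.IsHolomorphic E f
  finite_automorphism : Finite (C.Automorphism f)

end NodalCurve

end

/-! Since α is complex bilinear, Re α(iu, v) = -Im α(u, v), so `K_α v = 0` means α(u, v) = 0 for all
u: the kernel of `K_α` is the complex kernel of α (`kEndo_eq_zero_iff`). A nonzero alternating
2-form on a complex 3-space has rank two, so off the zero locus this kernel is a complex line,
locally spanned by a holomorphic vector field (`exists_holomorphic_field_spanning_ker`). In complex
rank one no involutivity condition arises: the complex-time flow of the field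
(`exists_holomorphic_flow`) straightens it, which gives flow boxes with plaques of real dimension
two and codimension four (`exists_flowBox_kEndo`).

Leaves are the classes of points joined by chains of plaques of countably many flow boxes. A leaf
meets each box in countably many plaques, and a countable set of transverse coordinates is totally
disconnected, so the plaques are exactly the connected components of leaf ∩ box
(`exists_isFoliationOf`).

For a curve tangent to the kernel, the transverse coordinate of any adapted chart has zero
derivative along the curve, so off the zeros of α the curve stays locally in one leaf
(`IsFoliationOf.exists_leaf_eventually`). Along the curve α is, in charts, a holomorphic function of
one variable: near each point it vanishes identically or has at most that point as a zero.
Connectedness selects one alternative on each component. In the second case punctured discs are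
connected, so the leaf does not change across a zero (`IsFoliationOf.exists_leaf_of_isConnected`),
and compactness leaves finitely many zeros. If α has no zeros, the preimages of the leaves are
disjoint open sets covering the connected curve. -/

/-! ### Holomorphic functions of several complex variables -/

section SeveralComplexVariables

open MeasureTheory Filter Metric
open scoped Topology

variable {E : Type*} [NormedAddCommGroup E] [NormedSpace ℂ E]
  {F : Type*} [NormedAddCommGroup F] [NormedSpace ℂ F]

/-- Cauchy's estimate for the Fréchet derivative of a bounded holomorphic function. -/
theorem norm_fderiv_le_of_forall_norm_le {f : E → F} {c : E} {r B : ℝ} (hr : 0 < r)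
    (hd : DifferentiableOn ℂ f (ball c r)) (hB : ∀ x ∈ ball c r, ‖f x‖ ≤ B) :
    ‖fderiv ℂ f c‖ ≤ 2 * B / r := by
  refine Complex.norm_fderiv_le_div_of_mapsTo_ball hd (fun x hx => ?_) hr
  rw [mem_closedBall, dist_eq_norm]
  have h1 := hB x hx
  have h2 := hB c (mem_ball_self hr)
  have := norm_sub_le (f x) (f c)
  linarith

/-- Reduces measurability of an operator-valued map to that of its values on vectors. -/
theorem ContinuousLinearMap.eq_sum_smulRight_basis [FiniteDimensional ℂ E] (L : E →L[ℂ] F) :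
    L = ∑ i, (LinearMap.toContinuousLinearMap
      ((Module.finBasis ℂ E).coord i)).smulRight (L (Module.finBasis ℂ E i)) := by
  ext x
  conv_lhs => rw [← (Module.finBasis ℂ E).sum_repr x, map_sum]
  simp

/-- An integral depending holomorphically on a parameter. -/
theorem differentiableOn_integral_of_norm_le [FiniteDimensional ℂ E]
    {T : Type*} [MeasurableSpace T] {μ : Measure T} [IsFiniteMeasure μ]
    {G : E → T → F} {U : Set E} (hU : IsOpen U) {B : ℝ}
    (hmeas : ∀ x ∈ U, AEStronglyMeasurable (G x) μ)
    (hd : ∀ᵐ s ∂μ, DifferentiableOn ℂ (fun x => G x s) U)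
    (hB : ∀ᵐ s ∂μ, ∀ x ∈ U, ‖G x s‖ ≤ B) :
    DifferentiableOn ℂ (fun x => ∫ s, G x s ∂μ) U := by
  classical
  intro x₀ hx₀
  obtain ⟨r, hr, hrU⟩ := Metric.isOpen_iff.1 hU x₀ hx₀
  have hsub : ∀ x ∈ ball x₀ (r / 2), ball x (r / 2) ⊆ U := fun x hx =>
    (ball_subset_ball' (by rw [mem_ball] at hx; linarith)).trans hrU
  have hbound : ∀ᵐ s ∂μ, ∀ x ∈ ball x₀ (r / 2),
      ‖fderiv ℂ (fun x => G x s) x‖ ≤ 2 * B / (r / 2) := by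
    filter_upwards [hd, hB] with s hds hBs x hx
    exact norm_fderiv_le_of_forall_norm_le (half_pos hr) (hds.mono (hsub x hx))
      fun y hy => hBs y (hsub x hx hy)
  have hdiff : ∀ᵐ s ∂μ, ∀ x ∈ ball x₀ (r / 2),
      HasFDerivAt (fun x => G x s) (fderiv ℂ (fun x => G x s) x) x := by
    filter_upwards [hd] with s hds x hx
    exact (hds.differentiableAt (hU.mem_nhds
      (hsub x hx (mem_ball_self (half_pos hr))))).hasFDerivAt
  have hdir : ∀ v : E, AEStronglyMeasurable (fun s => fderiv ℂ (fun x => G x s) x₀ v) μ := by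
    intro v
    -- Difference quotients are measurable in s, and so is their limit. The default 0 serves the
    -- finitely many n for which the displaced point may leave U.
    have hlim : ∀ᵐ s ∂μ, Tendsto (fun n : ℕ => if x₀ + ((n : ℂ)⁻¹) • v ∈ U then
        (n : ℂ) • (G (x₀ + ((n : ℂ)⁻¹) • v) s - G x₀ s) else 0) atTop
        (𝓝 (fderiv ℂ (fun x => G x s) x₀ v)) := by
      have htend : Tendsto (fun n : ℕ => x₀ + ((n : ℂ)⁻¹) • v) atTop (𝓝 x₀) := by
        have : Tendsto (fun n : ℕ => ((n : ℂ)⁻¹)) atTop (𝓝 0) :=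
          tendsto_inv_atTop_nhds_zero_nat
        simpa using tendsto_const_nhds.add (this.smul_const v)
      filter_upwards [hdiff] with s hs
      have h1 := (hs x₀ (mem_ball_self (half_pos hr))).lim v
        (c := fun n : ℕ => (n : ℂ)) (l := atTop) (by
          simpa using tendsto_natCast_atTop_atTop (R := ℝ))
      refine h1.congr' ?_
      filter_upwards [htend.eventually (hU.mem_nhds hx₀)] with n hn
      rw [if_pos (show _ ∈ U from hn)]
    refine aestronglyMeasurable_of_tendsto_ae atTop (fun n => ?_) hlim
    split_ifs with h
    · exact ((hmeas _ h).sub (hmeas _ hx₀)).const_smul _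
    · exact aestronglyMeasurable_const
  refine (hasFDerivAt_integral_of_dominated_of_fderiv_le
    (F' := fun x s => fderiv ℂ (fun x => G x s) x) (bound := fun _ => 2 * B / (r / 2))
    (ball_mem_nhds x₀ (half_pos hr)) ?_ ?_ ?_ hbound (integrable_const _)
    hdiff).differentiableAt.differentiableWithinAt
  · filter_upwards [hU.mem_nhds hx₀] with x hx using hmeas x hx
  · refine Integrable.of_bound (hmeas x₀ hx₀) B ?_
    filter_upwards [hB] with s hs using hs x₀ hx₀
  · have : (fun s => fderiv ℂ (fun x => G x s) x₀) = fun s => ∑ i,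
        (LinearMap.toContinuousLinearMap ((Module.finBasis ℂ E).coord i)).smulRight
          (fderiv ℂ (fun x => G x s) x₀ (Module.finBasis ℂ E i)) :=
      funext fun s => ContinuousLinearMap.eq_sum_smulRight_basis _
    simp only [this]
    refine Finset.aestronglyMeasurable_fun_sum _ fun i _ => ?_
    exact (ContinuousLinearMap.continuous
      ((ContinuousLinearMap.smulRightL ℂ E F) _)).comp_aestronglyMeasurable (hdir _)

/-- Every directional derivative of a holomorphic function is holomorphic. -/
theorem differentiableOn_fderiv_apply [FiniteDimensional ℂ E] [CompleteSpace F] {f : E → F}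
    {U : Set E} (hU : IsOpen U) (hf : DifferentiableOn ℂ f U) (v : E) :
    DifferentiableOn ℂ (fun x => fderiv ℂ f x v) U := by
  intro x₀ hx₀
  obtain ⟨r₁, hr₁, hB⟩ := Metric.eventually_nhds_iff_ball.1
    ((hf.continuousOn.continuousAt (hU.mem_nhds hx₀)).norm.eventually
      (gt_mem_nhds (lt_add_one ‖f x₀‖)))
  obtain ⟨r₂, hr₂, hrU⟩ := Metric.isOpen_iff.1 hU x₀ hx₀
  set r := min r₁ r₂ with hrdef
  have hr : 0 < r := lt_min hr₁ hr₂
  -- A disc of radius δ in the direction v moves a point by less than r / 2; the + 1 covers v = 0.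
  set δ : ℝ := r / 2 / (‖v‖ + 1) with hδ
  have hδ0 : 0 < δ := by positivity
  have hδv : ∀ z : ℂ, ‖z‖ ≤ δ → ‖z • v‖ < r / 2 := by
    intro z hz
    rw [norm_smul]
    have h1 : δ * (‖v‖ + 1) = r / 2 := by rw [hδ]; field_simp
    nlinarith [norm_nonneg v, norm_nonneg z]
  have hin : ∀ x ∈ ball x₀ (r / 2), ∀ z : ℂ, ‖z‖ ≤ δ → x + z • v ∈ ball x₀ r := by
    intro x hx z hz
    rw [mem_ball, dist_eq_norm] at hx ⊢
    have := hδv z hz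
    have := norm_add_le (x - x₀) (z • v)
    rw [show x + z • v - x₀ = x - x₀ + z • v by abel]
    linarith
  have hrU' : ball x₀ r ⊆ U := (ball_subset_ball (min_le_right _ _)).trans hrU
  -- Cauchy's formula on the complex line x + zv turns the derivative into an integral of values of
  -- f, which depends holomorphically on x.
  have hcauchy : ∀ x ∈ ball x₀ (r / 2), fderiv ℂ f x v =
      (2 * Real.pi * Complex.I : ℂ)⁻¹ • ∫ θ in Set.Ioc 0 (2 * Real.pi),
        deriv (circleMap 0 δ) θ • ((circleMap 0 δ θ - 0) ^ 2)⁻¹ •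
          f (x + circleMap 0 δ θ • v) := by
    intro x hx
    have hx' := hin x hx 0 (by simpa using hδ0.le)
    rw [zero_smul, add_zero] at hx'
    have hopen : IsOpen ((fun z : ℂ => x + z • v) ⁻¹' ball x₀ r) :=
      isOpen_ball.preimage (by fun_prop)
    have hline : DifferentiableOn ℂ (fun z : ℂ => f (x + z • v))
        ((fun z : ℂ => x + z • v) ⁻¹' ball x₀ r) :=
      (hf.mono hrU').comp (f := fun z : ℂ => x + z • v) (by fun_prop) fun z hz => hz
    have h1 := Complex.cderiv_eq_deriv hopen hline hδ0 (z := 0) fun z hz =>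
      hin x hx z (by simpa using hz)
    rw [Complex.cderiv, circleIntegral,
      intervalIntegral.integral_of_le (by positivity)] at h1
    rw [h1]
    have h2 : HasFDerivAt f (fderiv ℂ f x) (x + (0 : ℂ) • v) := by
      rw [zero_smul, add_zero]
      exact (hf.differentiableAt (hU.mem_nhds (hrU' hx'))).hasFDerivAt
    have h3 : HasDerivAt (fun z : ℂ => x + z • v) v 0 := by
      simpa using ((hasDerivAt_id (0 : ℂ)).smul_const v).const_add x
    exact (h2.comp_hasDerivAt (0 : ℂ) h3).deriv.symm
  have hmain : DifferentiableOn ℂ (fun x => ∫ θ in Set.Ioc 0 (2 * Real.pi),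
        deriv (circleMap 0 δ) θ • ((circleMap 0 δ θ - 0) ^ 2)⁻¹ •
          f (x + circleMap 0 δ θ • v)) (ball x₀ (r / 2)) := by
    have hmem : ∀ θ, ∀ x ∈ ball x₀ (r / 2), x + circleMap 0 δ θ • v ∈ ball x₀ r := fun θ x hx =>
      hin x hx _ (by simp [abs_of_pos hδ0])
    refine differentiableOn_integral_of_norm_le isOpen_ball
      (B := δ * ((δ ^ 2)⁻¹ * (‖f x₀‖ + 1))) (fun x hx => ?_)
      (Eventually.of_forall fun θ => ?_) (Eventually.of_forall fun θ x hx => ?_)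
    · refine Continuous.aestronglyMeasurable ?_
      have h1 : Continuous fun θ => f (x + circleMap 0 δ θ • v) :=
        (hf.mono hrU').continuousOn.comp_continuous (by fun_prop) fun θ => hmem θ x hx
      have h2 : Continuous fun θ => ((circleMap 0 δ θ - 0) ^ 2)⁻¹ :=
        Continuous.inv₀ (by fun_prop) fun θ => by
          simp [circleMap, hδ0.ne']
      have h3 : Continuous (deriv (circleMap 0 δ)) := by
        rw [show deriv (circleMap 0 δ) = fun θ => circleMap 0 δ θ * Complex.I from
          funext fun θ => deriv_circleMap 0 δ θ]
        fun_prop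
      exact h3.smul (h2.smul h1)
    · refine DifferentiableOn.const_smul (DifferentiableOn.const_smul ?_ _) _
      exact (hf.mono hrU').comp (f := fun x => x + circleMap 0 δ θ • v) (by fun_prop)
        fun x hx => hmem θ x hx
    · have h1 := (hB _ (ball_subset_ball (min_le_left r₁ r₂) (hmem θ x hx))).le
      rw [norm_smul, norm_smul, deriv_circleMap]
      simp only [sub_zero, norm_inv, norm_pow, norm_mul, Complex.norm_I, mul_one,
        norm_circleMap_zero, abs_of_pos hδ0]
      gcongr
  have hfin := (hmain.const_smul ((2 * Real.pi * Complex.I : ℂ)⁻¹)).congr hcauchy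
  exact (hfin.differentiableAt (ball_mem_nhds x₀ (half_pos hr))).differentiableWithinAt

/-- Holomorphic functions of several variables are smooth. -/
theorem contDiffOn_infty_of_differentiableOn [FiniteDimensional ℂ E] [CompleteSpace F] {f : E → F}
    {U : Set E} (hU : IsOpen U) (hf : DifferentiableOn ℂ f U) : ContDiffOn ℂ ∞ f U := by
  rw [contDiffOn_infty]
  intro n
  induction n generalizing f with
  | zero => simpa [contDiffOn_zero] using hf.continuousOn
  | succ n ih =>
    rw [Nat.cast_add, Nat.cast_one, contDiffOn_succ_iff_fderiv_of_isOpen hU]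
    exact ⟨hf, fun h => by simp at h, contDiffOn_clm_apply.2 fun v => ih (differentiableOn_fderiv_apply hU hf v)⟩

/-- A uniform limit of holomorphic functions of several variables is holomorphic. -/
theorem TendstoUniformlyOn.differentiableOn_complex [CompleteSpace F] {f : ℕ → E → F} {g : E → F}
    {U : Set E} (hU : IsOpen U) (h : TendstoUniformlyOn f g atTop U)
    (hf : ∀ n, DifferentiableOn ℂ (f n) U) : DifferentiableOn ℂ g U := by
  intro x₀ hx₀
  obtain ⟨r, hr, hrU⟩ := Metric.isOpen_iff.1 hU x₀ hx₀
  have hsub : ∀ x ∈ ball x₀ (r / 2), ball x (r / 2) ⊆ U := fun x hx =>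
    (ball_subset_ball' (by rw [mem_ball] at hx; linarith)).trans hrU
  have hmem : ∀ x ∈ ball x₀ (r / 2), x ∈ U := fun x hx =>
    hsub x hx (mem_ball_self (half_pos hr))
  -- Cauchy's estimate on balls of half the radius transfers uniform convergence to the derivatives.
  have hC : UniformCauchySeqOn (fun n => fderiv ℂ (f n)) atTop (ball x₀ (r / 2)) := by
    rw [Metric.uniformCauchySeqOn_iff]
    intro ε hε
    obtain ⟨N, hN⟩ := Metric.uniformCauchySeqOn_iff.1 h.uniformCauchySeqOn (ε * r / 8)
      (by positivity)
    refine ⟨N, fun m hm n hn x hx => ?_⟩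
    have h1 : ‖fderiv ℂ (fun y => f m y - f n y) x‖ ≤ 2 * (ε * r / 8) / (r / 2) := by
      refine norm_fderiv_le_of_forall_norm_le (half_pos hr)
        (((hf m).sub (hf n)).mono (hsub x hx)) fun y hy => ?_
      rw [← dist_eq_norm]
      exact (hN m hm n hn y (hsub x hx hy)).le
    rw [fderiv_fun_sub ((hf m).differentiableAt (hU.mem_nhds (hmem x hx)))
      ((hf n).differentiableAt (hU.mem_nhds (hmem x hx))), ← dist_eq_norm] at h1
    have h2 : 2 * (ε * r / 8) / (r / 2) = ε / 2 := by field_simp; norm_num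
    linarith
  have hlim : ∀ x ∈ ball x₀ (r / 2), ∃ L, Tendsto (fun n => fderiv ℂ (f n) x) atTop (𝓝 L) :=
    fun x hx => cauchySeq_tendsto_of_complete (hC.cauchySeq hx)
  choose! g' hg' using hlim
  exact (hasFDerivAt_of_tendstoUniformlyOn isOpen_ball (hC.tendstoUniformlyOn_of_tendsto hg')
    (fun n x hx => ((hf n).differentiableAt (hU.mem_nhds (hmem x hx))).hasFDerivAt)
    (fun x hx => h.tendsto_at (hmem x hx))
    (mem_ball_self (half_pos hr))).differentiableAt.differentiableWithinAt

end SeveralComplexVariables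

/-! ### The local flow of a holomorphic vector field -/

section HolomorphicFlow

open MeasureTheory Filter Metric Set
open scoped Topology NNReal

variable {E : Type*} [NormedAddCommGroup E] [NormedSpace ℂ E]

/-- The Picard operator of the vector field `V` in complex time. -/
noncomputable def complexPicard (V : E → E) (u : ℂ × E → E) (x : ℂ × E) : E :=
  -- The integral of V ∘ u along the segment from 0 to the complex time x.1, rescaled to [0, 1] so
  -- that the domain of integration does not depend on the time.
  x.2 + ∫ s in Ioc (0 : ℝ) 1, x.1 • V (u ((s : ℂ) * x.1, x.2))

theorem ofReal_mul_mem_ball {δ s : ℝ} (hs : s ∈ Icc (0 : ℝ) 1) {t : ℂ}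
    (ht : t ∈ ball (0 : ℂ) δ) : (s : ℂ) * t ∈ ball (0 : ℂ) δ := by
  rw [mem_ball_zero_iff] at ht ⊢
  rw [norm_mul, Complex.norm_real, Real.norm_of_nonneg hs.1]
  nlinarith [norm_nonneg t, hs.2]

theorem continuousOn_complexPicard_integrand {V : E → E} {u : ℂ × E → E} {z₀ : E}
    {δ ρ : ℝ} {W : Set E} (hV : ContinuousOn V W)
    (hu : ContinuousOn u (ball 0 δ ×ˢ ball z₀ ρ)) (hm : MapsTo u (ball 0 δ ×ˢ ball z₀ ρ) W)
    {x : ℂ × E} (hx : x ∈ ball (0 : ℂ) δ ×ˢ ball z₀ ρ) :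
    ContinuousOn (fun s : ℝ => x.1 • V (u ((s : ℂ) * x.1, x.2))) (Icc 0 1) := by
  have hmem : MapsTo (fun s : ℝ => (((s : ℂ) * x.1, x.2) : ℂ × E)) (Icc 0 1)
      (ball 0 δ ×ˢ ball z₀ ρ) := fun s hs => ⟨ofReal_mul_mem_ball hs hx.1, hx.2⟩
  refine ContinuousOn.const_smul ?_ x.1
  exact hV.comp (hu.comp (by fun_prop) hmem) (hm.comp hmem)

theorem norm_complexPicard_sub_le {V : E → E} {u : ℂ × E → E} {z₀ : E} {δ ρ B : ℝ} {W : Set E}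
    (hB : ∀ z ∈ W, ‖V z‖ ≤ B) (hm : MapsTo u (ball 0 δ ×ˢ ball z₀ ρ) W)
    {x : ℂ × E} (hx : x ∈ ball (0 : ℂ) δ ×ˢ ball z₀ ρ) :
    ‖complexPicard V u x - x.2‖ ≤ δ * B := by
  rw [complexPicard, add_sub_cancel_left]
  have h := norm_setIntegral_le_of_norm_le_const (μ := volume) (s := Ioc (0 : ℝ) 1)
    (f := fun s : ℝ => x.1 • V (u ((s : ℂ) * x.1, x.2))) (C := δ * B) (by simp) fun s hs => ?_
  · simpa using h
  · have h1 := hB _ (hm (show ((s : ℂ) * x.1, x.2) ∈ _ from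
      ⟨ofReal_mul_mem_ball (Ioc_subset_Icc_self hs) hx.1, hx.2⟩))
    have h2 := (mem_ball_zero_iff.1 hx.1).le
    have h3 := (norm_nonneg _).trans h2
    rw [norm_smul]
    gcongr

theorem differentiableOn_complexPicard [FiniteDimensional ℂ E] {V : E → E} {u : ℂ × E → E}
    {z₀ : E} {δ ρ B : ℝ} {W : Set E} (hV : DifferentiableOn ℂ V W) (hB : ∀ z ∈ W, ‖V z‖ ≤ B)
    (hu : DifferentiableOn ℂ u (ball 0 δ ×ˢ ball z₀ ρ))
    (hm : MapsTo u (ball 0 δ ×ˢ ball z₀ ρ) W) :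
    DifferentiableOn ℂ (complexPicard V u) (ball 0 δ ×ˢ ball z₀ ρ) := by
  refine differentiableOn_snd.add (differentiableOn_integral_of_norm_le
    (isOpen_ball.prod isOpen_ball) (B := δ * B) (fun x hx => ?_)
    (ae_restrict_of_forall_mem measurableSet_Ioc fun s hs => ?_)
    (ae_restrict_of_forall_mem measurableSet_Ioc fun s hs x hx => ?_))
  · exact ((continuousOn_complexPicard_integrand hV.continuousOn hu.continuousOn hm hx).mono
      Ioc_subset_Icc_self).aestronglyMeasurable measurableSet_Ioc
  · have hmem : MapsTo (fun x : ℂ × E => (((s : ℂ) * x.1, x.2) : ℂ × E))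
        (ball 0 δ ×ˢ ball z₀ ρ) (ball 0 δ ×ˢ ball z₀ ρ) := fun x hx =>
      ⟨ofReal_mul_mem_ball (Ioc_subset_Icc_self hs) hx.1, hx.2⟩
    refine differentiableOn_fst.smul ?_
    exact hV.comp (hu.comp (by fun_prop) hmem) (hm.comp hmem)
  · have h1 := hB _ (hm (show ((s : ℂ) * x.1, x.2) ∈ _ from
      ⟨ofReal_mul_mem_ball (Ioc_subset_Icc_self hs) hx.1, hx.2⟩))
    have h2 := (mem_ball_zero_iff.1 hx.1).le
    have h3 := (norm_nonneg _).trans h2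
    rw [norm_smul]
    gcongr

theorem norm_complexPicard_sub_complexPicard_le {V : E → E} {u v : ℂ × E → E} {z₀ : E}
    {δ ρ c : ℝ} {K : ℝ≥0} {W : Set E} (hV : LipschitzOnWith K V W)
    (hu : ContinuousOn u (ball 0 δ ×ˢ ball z₀ ρ)) (hum : MapsTo u (ball 0 δ ×ˢ ball z₀ ρ) W)
    (hv : ContinuousOn v (ball 0 δ ×ˢ ball z₀ ρ)) (hvm : MapsTo v (ball 0 δ ×ˢ ball z₀ ρ) W)
    (huv : ∀ x ∈ ball (0 : ℂ) δ ×ˢ ball z₀ ρ, ‖u x - v x‖ ≤ c)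
    {x : ℂ × E} (hx : x ∈ ball (0 : ℂ) δ ×ˢ ball z₀ ρ) :
    ‖complexPicard V u x - complexPicard V v x‖ ≤ δ * (K * c) := by
  have hint : ∀ {w : ℂ × E → E}, ContinuousOn w (ball 0 δ ×ˢ ball z₀ ρ) →
      MapsTo w (ball 0 δ ×ˢ ball z₀ ρ) W →
      IntegrableOn (fun s : ℝ => x.1 • V (w ((s : ℂ) * x.1, x.2))) (Ioc 0 1) := fun hw hwm =>
    ((continuousOn_complexPicard_integrand hV.continuousOn hw hwm hx).integrableOn_Icc).mono_set
      Ioc_subset_Icc_self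
  rw [complexPicard, complexPicard, add_sub_add_left_eq_sub, ← integral_sub (hint hu hum)
    (hint hv hvm)]
  have h := norm_setIntegral_le_of_norm_le_const (μ := volume) (s := Ioc (0 : ℝ) 1)
    (f := fun s : ℝ => x.1 • V (u ((s : ℂ) * x.1, x.2)) - x.1 • V (v ((s : ℂ) * x.1, x.2)))
    (C := δ * (K * c)) (by simp) fun s hs => ?_
  · simpa using h
  · have hmem : ((s : ℂ) * x.1, x.2) ∈ ball (0 : ℂ) δ ×ˢ ball z₀ ρ :=
      ⟨ofReal_mul_mem_ball (Ioc_subset_Icc_self hs) hx.1, hx.2⟩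
    have h1 := hV.norm_sub_le (hum hmem) (hvm hmem)
    have h2 := (mem_ball_zero_iff.1 hx.1).le
    have h3 := huv _ hmem
    rw [← smul_sub, norm_smul]
    have hc : 0 ≤ c := (norm_nonneg _).trans h3
    refine mul_le_mul h2 (h1.trans (by gcongr)) (norm_nonneg _) ((norm_nonneg _).trans h2)

/-- On a disc the holomorphic function t ↦ V(u(t, y)) has a primitive g, so the integral along the
segment is g(t) - g(0), whose complex derivative is the integrand. -/
theorem hasDerivAt_of_complexPicard_eq [CompleteSpace E] {V : E → E} {u : ℂ × E → E}
    {z₀ : E} {δ ρ : ℝ} {W : Set E} (hV : DifferentiableOn ℂ V W)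
    (hu : DifferentiableOn ℂ u (ball 0 δ ×ˢ ball z₀ ρ))
    (hm : MapsTo u (ball 0 δ ×ˢ ball z₀ ρ) W)
    (heq : ∀ x ∈ ball (0 : ℂ) δ ×ˢ ball z₀ ρ, complexPicard V u x = u x)
    {t : ℂ} (ht : t ∈ ball (0 : ℂ) δ) {y : E} (hy : y ∈ ball z₀ ρ) :
    HasDerivAt (fun t => u (t, y)) (V (u (t, y))) t := by
  have hF : DifferentiableOn ℂ (fun t => V (u (t, y))) (ball 0 δ) := by
    have hmem : MapsTo (fun t : ℂ => ((t, y) : ℂ × E)) (ball 0 δ) (ball 0 δ ×ˢ ball z₀ ρ) :=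
      fun t ht => ⟨ht, hy⟩
    exact hV.comp (hu.comp (by fun_prop) hmem) (hm.comp hmem)
  obtain ⟨g, hg⟩ := hF.isExactOn_ball
  have key : ∀ τ ∈ ball (0 : ℂ) δ, u (τ, y) = y + (g τ - g 0) := by
    intro τ hτ
    have hx : (τ, y) ∈ ball (0 : ℂ) δ ×ˢ ball z₀ ρ := ⟨hτ, hy⟩
    rw [← heq _ hx, complexPicard, ← intervalIntegral.integral_of_le zero_le_one]
    have hcont := continuousOn_complexPicard_integrand hV.continuousOn hu.continuousOn hm hx
    rw [intervalIntegral.integral_eq_sub_of_hasDerivAt (f := fun s : ℝ => g ((s : ℂ) * τ))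
      (fun s hs => ?_) ((uIcc_of_le (zero_le_one (α := ℝ))).symm ▸ hcont).intervalIntegrable]
    · simp
    · rw [uIcc_of_le zero_le_one] at hs
      have h1 := hg _ (ofReal_mul_mem_ball hs hτ)
      have h2 : HasDerivAt (fun s : ℝ => (s : ℂ) * τ) τ s := by
        simpa using (Complex.ofRealCLM.hasDerivAt (x := s)).mul_const τ
      exact h1.scomp s h2
  have h := ((hg t ht).sub_const (g 0)).const_add y
  refine h.congr_of_eventuallyEq ?_
  filter_upwards [isOpen_ball.mem_nhds ht] with τ hτ using key τ hτ

/-- The local flow of a holomorphic vector field, in complex time, is holomorphic. -/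
theorem exists_holomorphic_flow [FiniteDimensional ℂ E] {V : E → E} {U : Set E} (hU : IsOpen U)
    (hV : DifferentiableOn ℂ V U) {z₀ : E} (hz₀ : z₀ ∈ U) :
    ∃ δ > 0, ∃ ρ > 0, ∃ u : ℂ × E → E,
      DifferentiableOn ℂ u (ball 0 δ ×ˢ ball z₀ ρ) ∧ MapsTo u (ball 0 δ ×ˢ ball z₀ ρ) U ∧
      (∀ y ∈ ball z₀ ρ, u (0, y) = y) ∧
      ∀ t ∈ ball (0 : ℂ) δ, ∀ y ∈ ball z₀ ρ, HasDerivAt (fun t => u (t, y)) (V (u (t, y))) t := by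
  have : CompleteSpace E := FiniteDimensional.complete ℂ E
  obtain ⟨K, s, hs, hK⟩ := (((contDiffOn_infty_of_differentiableOn hU hV).contDiffAt
    (hU.mem_nhds hz₀)).of_le (m := 1) (by simp)).exists_lipschitzOnWith
  obtain ⟨R, hR, hball⟩ := Metric.mem_nhds_iff.1 (inter_mem (inter_mem hs (hU.mem_nhds hz₀))
    ((hV.continuousOn.continuousAt (hU.mem_nhds hz₀)).norm.eventually
      (gt_mem_nhds (lt_add_one ‖V z₀‖))))
  set W := ball z₀ R with hW
  set B := ‖V z₀‖ + 1 with hBdef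
  have hB0 : 0 < B := by positivity
  have hKW : LipschitzOnWith K V W := hK.mono fun z hz => (hball hz).1.1
  have hWU : W ⊆ U := fun z hz => (hball hz).1.2
  have hB : ∀ z ∈ W, ‖V z‖ ≤ B := fun z hz => (show ‖V z‖ < B from (hball hz).2).le
  have hVW := hV.mono hWU
  -- The first bound keeps the iterates within R / 4 of the initial point; the second makes the
  -- Picard operator contract by 1/2, with K + 1 covering K = 0.
  set δ := min (R / (4 * B)) (1 / (2 * (K + 1))) with hδ
  have hδ0 : 0 < δ := by positivity
  have hδB : δ * B ≤ R / 4 := by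
    calc δ * B ≤ R / (4 * B) * B := by gcongr; exact min_le_left _ _
      _ = R / 4 := by field_simp
  have hδK : ∀ c, 0 ≤ c → δ * (K * c) ≤ c / 2 := by
    intro c hc
    calc δ * (K * c) ≤ 1 / (2 * (K + 1)) * ((K + 1) * c) := by
          gcongr
          · exact min_le_right _ _
          · linarith
      _ = c / 2 := by field_simp
  -- Initial points lie within R / 2 of z₀, so a displacement of at most R / 4 stays inside W.
  set Ω := ball (0 : ℂ) δ ×ˢ ball z₀ (R / 2) with hΩ
  have hΩo : IsOpen Ω := isOpen_ball.prod isOpen_ball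
  have hnear : ∀ (v : ℂ × E → E), (∀ x ∈ Ω, ‖v x - x.2‖ ≤ R / 4) → MapsTo v Ω W := by
    intro v hv x hx
    have h1 := hv x hx
    have h2 := mem_ball_iff_norm.1 hx.2
    rw [hW, mem_ball_iff_norm]
    have := norm_add_le (v x - x.2) (x.2 - z₀)
    rw [sub_add_sub_cancel] at this
    linarith
  set f : ℕ → ℂ × E → E := fun n => (complexPicard V)^[n] Prod.snd with hf
  have hfs : ∀ n, f (n + 1) = complexPicard V (f n) := fun n =>
    Function.iterate_succ_apply' _ _ _
  have hind : ∀ n, DifferentiableOn ℂ (f n) Ω ∧ ∀ x ∈ Ω, ‖f n x - x.2‖ ≤ R / 4 := by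
    intro n
    induction n with
    | zero => exact ⟨differentiableOn_snd, fun x hx => by simp [f]; positivity⟩
    | succ n ih =>
      rw [hfs]
      exact ⟨differentiableOn_complexPicard hVW hB ih.1 (hnear _ ih.2), fun x hx =>
        (norm_complexPicard_sub_le hB (hnear _ ih.2) hx).trans hδB⟩
  have hgeo : ∀ n, ∀ x ∈ Ω, ‖f n x - f (n + 1) x‖ ≤ R / 2 / 2 ^ n := by
    intro n
    induction n with
    | zero =>
      intro x hx
      have := (hind 1).2 x hx
      rw [norm_sub_rev]
      simp only [f, Function.iterate_zero, id] at this ⊢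
      simp only [pow_zero, div_one, zero_add]
      linarith
    | succ n ih =>
      intro x hx
      rw [hfs (n + 1), hfs n]
      have h := norm_complexPicard_sub_complexPicard_le hKW (hind n).1.continuousOn
        (hnear _ (hind n).2) (hind (n + 1)).1.continuousOn (hnear _ (hind (n + 1)).2) ih hx
      rw [hfs n] at h
      refine (h.trans (hδK _ (by positivity))).trans (le_of_eq ?_)
      rw [pow_succ]; field_simp
  have hgeo' : ∀ x ∈ Ω, ∀ n, dist (f n x) (f (n + 1) x) ≤ R / 2 / 2 ^ n := fun x hx n => by
    rw [dist_eq_norm]; exact hgeo n x hx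
  have hlim : ∀ x, ∃ l, x ∈ Ω → Tendsto (fun n => f n x) atTop (𝓝 l) := by
    intro x
    by_cases hx : x ∈ Ω
    · obtain ⟨l, hl⟩ := cauchySeq_tendsto_of_complete (cauchySeq_of_le_geometric_two (hgeo' x hx))
      exact ⟨l, fun _ => hl⟩
    · exact ⟨0, fun h => absurd h hx⟩
  choose u hu using hlim
  have hdist : ∀ n, ∀ x ∈ Ω, ‖f n x - u x‖ ≤ R / 2 ^ n := fun n x hx => by
    rw [← dist_eq_norm]
    exact dist_le_of_le_geometric_two_of_tendsto (hgeo' x hx) (hu x hx) n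
  have hR0 : ∀ C : ℝ, Tendsto (fun n : ℕ => C / 2 ^ n) atTop (𝓝 0) := fun C => by
    simpa [div_eq_mul_inv] using (tendsto_pow_atTop_nhds_zero_of_lt_one (r := (2 : ℝ)⁻¹)
      (by norm_num) (by norm_num)).const_mul C
  have hunif : TendstoUniformlyOn f u atTop Ω := by
    rw [Metric.tendstoUniformlyOn_iff]
    intro ε hε
    filter_upwards [(hR0 R).eventually (gt_mem_nhds hε)] with n hn x hx
    rw [dist_comm, dist_eq_norm]
    exact (hdist n x hx).trans_lt hn
  have hud : DifferentiableOn ℂ u Ω := hunif.differentiableOn_complex hΩo fun n => (hind n).1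
  have hunear : ∀ x ∈ Ω, ‖u x - x.2‖ ≤ R / 4 := fun x hx =>
    le_of_tendsto ((hu x hx).sub_const x.2).norm (Eventually.of_forall fun n => (hind n).2 x hx)
  have hum := hnear u hunear
  -- Both sides are within a constant times 2⁻ⁿ of the iterate `f (n + 1)`.
  have heq : ∀ x ∈ Ω, complexPicard V u x = u x := by
    intro x hx
    rw [← sub_eq_zero, ← norm_eq_zero]
    refine le_antisymm (ge_of_tendsto' (hR0 (R * 2)) fun n => ?_) (norm_nonneg _)
    have h1 := norm_complexPicard_sub_complexPicard_le hKW (hind n).1.continuousOn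
        (hnear _ (hind n).2) hud.continuousOn hum (hdist n) hx
    rw [← hfs, norm_sub_rev] at h1
    have h2 := hdist (n + 1) x hx
    have h3 := hδK (R / 2 ^ n) (by positivity)
    have h4 := norm_add_le (complexPicard V u x - f (n + 1) x) (f (n + 1) x - u x)
    rw [sub_add_sub_cancel] at h4
    have h5 : R / 2 ^ (n + 1) = R / 2 ^ n / 2 := by rw [pow_succ]; field_simp
    have h6 : R * 2 / 2 ^ n = R / 2 ^ n * 2 := by ring
    have h7 : 0 ≤ R / 2 ^ n := by positivity
    linarith
  refine ⟨δ, hδ0, R / 2, half_pos hR, u, hud, hum.mono_right hWU, fun y hy => ?_,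
    fun t ht y hy => hasDerivAt_of_complexPicard_eq hVW hud hum heq ht hy⟩
  rw [← heq (0, y) ⟨mem_ball_self hδ0, hy⟩]
  simp [complexPicard]

end HolomorphicFlow

/-! ### Straightening the kernel of a holomorphic 2-form on a three-dimensional space -/

section AlternatingForms

variable {V : Type*} [NormedAddCommGroup V] [NormedSpace ℂ V] (a : V [⋀^Fin 2]→L[ℂ] ℂ)

theorem alternating_two_add_right (u v v' : V) : a ![u, v + v'] = a ![u, v] + a ![u, v'] := by
  simpa only [update_vec2_one] using a.map_update_add ![u, v] 1 v v'

theorem alternating_two_add_left (u u' v : V) : a ![u + u', v] = a ![u, v] + a ![u', v] := by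
  simpa only [update_vec2_zero] using a.map_update_add ![u, v] 0 u u'

theorem alternating_two_smul_right (c : ℂ) (u v : V) : a ![u, c • v] = c * a ![u, v] := by
  simpa only [update_vec2_one, smul_eq_mul] using a.map_update_smul ![u, v] 1 c v

theorem alternating_two_smul_left (c : ℂ) (u v : V) : a ![c • u, v] = c * a ![u, v] := by
  simpa only [update_vec2_zero, smul_eq_mul] using a.map_update_smul ![u, v] 0 c u

theorem alternating_two_self (u : V) : a ![u, u] = 0 :=
  a.map_eq_zero_of_eq ![u, u] (i := 0) (j := 1) rfl (by decide)

theorem alternating_two_swap (u v : V) : a ![v, u] = - a ![u, v] := by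
  have h := alternating_two_self a (u + v)
  rw [alternating_two_add_right, alternating_two_add_left, alternating_two_add_left,
    alternating_two_self, alternating_two_self, zero_add, add_zero] at h
  exact eq_neg_of_add_eq_zero_left h

theorem exists_alternating_two_ne_zero {a : V [⋀^Fin 2]→L[ℂ] ℂ} (ha : a ≠ 0) :
    ∃ u v, a ![u, v] ≠ 0 := by
  by_contra! h
  refine ha (ContinuousAlternatingMap.ext fun w => ?_)
  have hw : w = ![w 0, w 1] := by ext i; fin_cases i <;> rfl
  rw [hw, h]; rfl

end AlternatingForms

/-! ### Flow boxes for the kernel of a holomorphic 2-form. -/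

section Straightening

open Metric Set Filter
open scoped Topology

variable {E : Type*} [NormedAddCommGroup E] [NormedSpace ℂ E] [FiniteDimensional ℂ E]

/-- Near a point where it does not vanish, the kernel of a holomorphic 2-form on a
three-dimensional space is spanned by a holomorphic vector field. -/
theorem exists_holomorphic_field_spanning_ker (hE : Module.finrank ℂ E = 3)
    {β : E → E [⋀^Fin 2]→L[ℂ] ℂ} {U : Set E} (hU : IsOpen U) (hβ : DifferentiableOn ℂ β U)
    {z₀ : E} (hz₀ : z₀ ∈ U) (h0 : β z₀ ≠ 0) :
    ∃ U' : Set E, IsOpen U' ∧ z₀ ∈ U' ∧ U' ⊆ U ∧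
      ∃ (V : E → E) (T : (ℂ × (ℂ × ℂ)) ≃L[ℂ] E), DifferentiableOn ℂ V U' ∧
        (∀ z ∈ U', (T.symm (V z)).1 = 1) ∧
        ∀ z ∈ U', ∀ v, (∀ u, β z ![u, v] = 0) ↔ ∃ c : ℂ, v = c • V z := by
  obtain ⟨u₁, u₂, hu⟩ := exists_alternating_two_ne_zero h0
  obtain ⟨v₀, hv₀⟩ : ∃ v₀, v₀ ∉ Submodule.span ℂ {u₁, u₂} := by
    by_contra! h
    have h1 : Submodule.span ℂ {u₁, u₂} = ⊤ := eq_top_iff.2 fun x _ => h x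
    have h2 : Module.finrank ℂ (Submodule.span ℂ {u₁, u₂}) ≤ 2 := by
      classical
      have h3 := finrank_span_finset_le_card (R := ℂ) ({u₁, u₂} : Finset E)
      rw [Finset.coe_pair] at h3
      exact h3.trans Finset.card_le_two
    rw [h1, finrank_top] at h2
    omega
  let T₀ : (ℂ × (ℂ × ℂ)) →ₗ[ℂ] E :=
    (LinearMap.toSpanSingleton ℂ E v₀).coprod
      ((LinearMap.toSpanSingleton ℂ E u₁).coprod (LinearMap.toSpanSingleton ℂ E u₂))
  have hT₀ : ∀ x, T₀ x = x.1 • v₀ + (x.2.1 • u₁ + x.2.2 • u₂) := fun x => by simp [T₀]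
  have hinj : Function.Injective T₀ := by
    rw [← LinearMap.ker_eq_bot, LinearMap.ker_eq_bot']
    rintro ⟨c, a, b⟩ h
    rw [hT₀] at h
    simp only at h
    have hc : c = 0 := by
      by_contra hc
      refine hv₀ (Submodule.mem_span_pair.2 ⟨-(c⁻¹ * a), -(c⁻¹ * b), ?_⟩)
      have h1 : c • v₀ = -(a • u₁ + b • u₂) := eq_neg_of_add_eq_zero_left h
      have h2 : v₀ = c⁻¹ • (c • v₀) := by rw [smul_smul, inv_mul_cancel₀ hc, one_smul]
      rw [h2, h1]
      module
    subst hc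
    rw [zero_smul, zero_add] at h
    have hb : b = 0 := by
      have h1 := alternating_two_add_right (β z₀) u₁ (a • u₁) (b • u₂)
      rw [h, alternating_two_smul_right, alternating_two_smul_right, alternating_two_self] at h1
      have h2 : β z₀ ![u₁, 0] = 0 := by
        simpa using alternating_two_smul_right (β z₀) 0 u₁ 0
      rw [h2, mul_zero, zero_add] at h1
      exact (mul_eq_zero.1 h1.symm).resolve_right hu
    have ha : a = 0 := by
      have h1 := alternating_two_add_left (β z₀) (a • u₁) (b • u₂) u₂
      rw [h, alternating_two_smul_left, alternating_two_smul_left, alternating_two_self] at h1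
      have h2 : β z₀ ![0, u₂] = 0 := by
        simpa using alternating_two_smul_left (β z₀) 0 0 u₂
      rw [h2, mul_zero, add_zero] at h1
      exact (mul_eq_zero.1 h1.symm).resolve_right hu
    rw [ha, hb]; rfl
  let T : (ℂ × (ℂ × ℂ)) ≃L[ℂ] E :=
    (LinearMap.linearEquivOfInjective T₀ hinj (by simp [hE])).toContinuousLinearEquiv
  have hT : ∀ x, T x = x.1 • v₀ + (x.2.1 • u₁ + x.2.2 • u₂) := hT₀
  have hev : ∀ u v : E, DifferentiableOn ℂ (fun z => β z ![u, v]) U := fun u v =>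
    (ContinuousAlternatingMap.apply ℂ E ℂ ![u, v]).differentiable.comp_differentiableOn hβ
  have hsm : ∀ (f : E → ℂ), DifferentiableOn ℂ f U → IsOpen (U ∩ {z | f z ≠ 0}) :=
    fun f hf => hf.continuousOn.isOpen_inter_preimage hU isOpen_ne
  -- The field is v₀ + a u₁ + b u₂, with a and b solving β(u₁, ·) = β(u₂, ·) = 0; then β(v₀, ·) = 0
  -- follows by antisymmetry. Its v₀-coordinate 1 keeps it transverse to the span of u₁ and u₂.
  refine ⟨U ∩ {z | β z ![u₁, u₂] ≠ 0}, hsm _ (hev u₁ u₂), ⟨hz₀, hu⟩, inter_subset_left,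
    fun z => T (1, (β z ![u₂, v₀] / β z ![u₁, u₂], -(β z ![u₁, v₀] / β z ![u₁, u₂]))), T,
    ?_, fun z _ => by simp, ?_⟩
  · have hd : ∀ u v : E, DifferentiableOn ℂ (fun z => β z ![u, v] / β z ![u₁, u₂])
        (U ∩ {z | β z ![u₁, u₂] ≠ 0}) := fun u v => by
      simp only [div_eq_mul_inv]
      exact ((hev u v).mono inter_subset_left).mul
        (((hev u₁ u₂).mono inter_subset_left).inv fun z hz => hz.2)
    exact T.differentiable.comp_differentiableOn
      ((differentiableOn_const 1).prodMk ((hd u₂ v₀).prodMk (hd u₁ v₀).neg))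
  · rintro z ⟨-, hz⟩ v
    change β z ![u₁, u₂] ≠ 0 at hz
    constructor
    · intro h
      refine ⟨(T.symm v).1, ?_⟩
      set x := T.symm v with hx
      have hv : v = x.1 • v₀ + (x.2.1 • u₁ + x.2.2 • u₂) := by
        rw [← hT, hx, T.apply_symm_apply]
      have h1 := h u₁
      have h2 := h u₂
      rw [hv] at h1 h2
      simp only [alternating_two_add_right, alternating_two_smul_right,
        alternating_two_self] at h1 h2
      rw [alternating_two_swap (β z) u₁ u₂] at h2
      rw [← map_smul, ← T.apply_symm_apply v, ← hx]
      congr 1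
      refine Prod.ext (by simp) (Prod.ext ?_ ?_)
      · simp only [Prod.smul_snd, Prod.smul_fst, smul_eq_mul]
        rw [← mul_div_assoc, eq_div_iff hz]
        linear_combination -h2
      · simp only [Prod.smul_snd, smul_eq_mul]
        rw [mul_neg, ← mul_div_assoc, ← neg_div, eq_div_iff hz]
        linear_combination h1
    · rintro ⟨c, rfl⟩ u
      rw [alternating_two_smul_right]
      refine mul_eq_zero_of_right _ ?_
      have hw : u = (T.symm u).1 • v₀ + ((T.symm u).2.1 • u₁ + (T.symm u).2.2 • u₂) := by
        rw [← hT, T.apply_symm_apply]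
      rw [hw]
      beta_reduce
      rw [hT]
      simp only [alternating_two_add_right, alternating_two_smul_right, alternating_two_self,
        alternating_two_add_left, alternating_two_smul_left]
      rw [alternating_two_swap (β z) u₁ u₂, alternating_two_swap (β z) u₂ v₀,
        alternating_two_swap (β z) u₁ v₀]
      field_simp
      ring

/-- A holomorphic vector field is straightened by a biholomorphic map near a point where it is
transverse to a given hyperplane. -/
theorem exists_straightening {G : Type*} [NormedAddCommGroup G] [NormedSpace ℂ G]
    {V : E → E} {U : Set E} (hU : IsOpen U) (hV : DifferentiableOn ℂ V U) {z₀ : E}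
    (hz₀ : z₀ ∈ U) (T : (ℂ × G) ≃L[ℂ] E) (hT : (T.symm (V z₀)).1 ≠ 0) :
    ∃ h : OpenPartialHomeomorph (ℂ × G) E, 0 ∈ h.source ∧ h 0 = z₀ ∧ h.target ⊆ U ∧
      ContDiffOn ℂ ∞ h h.source ∧ ContDiffOn ℂ ∞ h.symm h.target ∧
      (∀ p ∈ h.source, ∃ L : (ℂ × G) ≃L[ℂ] E, HasFDerivAt h (L : (ℂ × G) →L[ℂ] E) p ∧
        L (1, 0) = V (h p)) := by
  have : CompleteSpace E := FiniteDimensional.complete ℂ E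
  have : FiniteDimensional ℂ (ℂ × G) := T.symm.toLinearEquiv.finiteDimensional
  have : CompleteSpace (ℂ × G) := FiniteDimensional.complete ℂ _
  obtain ⟨δ, hδ, ρ, hρ, u, hud, hum, hu0, hut⟩ := exists_holomorphic_flow hU hV hz₀
  have hΩ : IsOpen (ball (0 : ℂ) δ ×ˢ ball z₀ ρ) := isOpen_ball.prod isOpen_ball
  -- The straightening map flows for time p.1 from the point T(0, p.2) of a slice through z₀. At 0
  -- its derivative is V(z₀) in time and T(0, ·) along the slice, hence invertible by
  -- transversality.
  let j : ℂ × G → ℂ × E := fun p => (p.1, z₀ + T (0, p.2))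
  have hj : Differentiable ℂ j := by
    refine differentiable_fst.prodMk ((differentiable_const z₀).add ?_)
    exact T.differentiable.comp ((differentiable_const (0 : ℂ)).prodMk differentiable_snd)
  let O : Set (ℂ × G) := j ⁻¹' (ball (0 : ℂ) δ ×ˢ ball z₀ ρ)
  have hO : IsOpen O := hΩ.preimage hj.continuous
  have hO0 : (0 : ℂ × G) ∈ O := by
    have h1 : T (0, 0) = 0 := map_zero T
    simp [O, j, h1, hδ, hρ]
  let H : ℂ × G → E := fun p => u (j p)
  have hHd : DifferentiableOn ℂ H O := hud.comp hj.differentiableOn fun p hp => hp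
  have hHs : ContDiffOn ℂ ∞ H O := contDiffOn_infty_of_differentiableOn hO hHd
  have hHF : ∀ p ∈ O, HasFDerivAt H (fderiv ℂ H p) p := fun p hp =>
    (hHd.differentiableAt (hO.mem_nhds hp)).hasFDerivAt
  have htime : ∀ p ∈ O, fderiv ℂ H p (1, 0) = V (H p) := by
    intro p hp
    have h1 : HasDerivAt (fun t : ℂ => ((t, p.2) : ℂ × G)) (1, 0) p.1 :=
      (hasDerivAt_id p.1).prodMk (hasDerivAt_const p.1 p.2)
    have h2 : HasDerivAt (fun t : ℂ => H (t, p.2)) (fderiv ℂ H p (1, 0)) p.1 :=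
      HasFDerivAt.comp_hasDerivAt (l := H) (f := fun t : ℂ => (t, p.2)) p.1 (hHF p hp) h1
    exact h2.unique (hut p.1 hp.1 _ hp.2)
  have hspace : ∀ y : G, fderiv ℂ H 0 (0, y) = T (0, y) := by
    intro y
    have h1 : HasFDerivAt (fun y : G => ((0, y) : ℂ × G)) (ContinuousLinearMap.inr ℂ ℂ G) 0 :=
      (ContinuousLinearMap.inr ℂ ℂ G).hasFDerivAt
    have h2 : HasFDerivAt (fun y : G => H (0, y)) ((fderiv ℂ H 0).comp
        (ContinuousLinearMap.inr ℂ ℂ G)) 0 := (hHF 0 hO0).comp (0 : G) h1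
    have h3 : HasFDerivAt (fun y : G => z₀ + T (0, y)) ((T : (ℂ × G) →L[ℂ] E).comp
        (ContinuousLinearMap.inr ℂ ℂ G)) 0 :=
      ((T : (ℂ × G) →L[ℂ] E).hasFDerivAt.comp (0 : G) h1).const_add z₀
    have h4 : (fun y : G => H (0, y)) =ᶠ[𝓝 0] fun y => z₀ + T (0, y) := by
      have h5 : (fun y : G => ((0, y) : ℂ × G)) ⁻¹' O ∈ 𝓝 0 :=
        (hO.preimage (by fun_prop)).mem_nhds hO0
      filter_upwards [h5] with y hy using hu0 _ hy.2
    exact congrArg (fun L : G →L[ℂ] E => L y) (h2.unique (h3.congr_of_eventuallyEq h4))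
  have hH0 : H 0 = z₀ := by
    have h1 : j 0 = (0, z₀) := by
      have h2 : T (0, 0) = 0 := map_zero T
      simp [j, h2]
    change u (j 0) = z₀
    rw [h1, hu0 z₀ (mem_ball_self hρ)]
  have hinj : Function.Injective (fderiv ℂ H 0 : (ℂ × G) →ₗ[ℂ] E) := by
    rw [← LinearMap.ker_eq_bot, LinearMap.ker_eq_bot']
    rintro ⟨τ, y⟩ h
    have h1 : ((τ, y) : ℂ × G) = τ • (1, 0) + (0, y) := by simp
    rw [ContinuousLinearMap.coe_coe, h1, map_add, map_smul, htime 0 hO0, hspace, hH0] at h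
    have h2 := congrArg (fun w => (T.symm w).1) h
    simp only [map_add, map_smul, T.symm_apply_apply, Prod.fst_add, Prod.smul_fst, add_zero,
      map_zero, Prod.fst_zero, smul_eq_mul] at h2
    have hτ : τ = 0 := (mul_eq_zero.1 h2).resolve_right hT
    subst hτ
    rw [zero_smul, zero_add] at h
    exact T.map_eq_zero_iff.1 h
  let L₀ : (ℂ × G) ≃L[ℂ] E := (LinearMap.linearEquivOfInjective _ hinj
    T.toLinearEquiv.finrank_eq).toContinuousLinearEquiv
  have hL₀ : (L₀ : (ℂ × G) →L[ℂ] E) = fderiv ℂ H 0 := by ext <;> rfl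
  have hstrict : HasStrictFDerivAt H (L₀ : (ℂ × G) →L[ℂ] E) 0 := by
    rw [hL₀]
    exact (hHs.contDiffAt (hO.mem_nhds hO0)).hasStrictFDerivAt (by simp)
  let h₀ := hstrict.toOpenPartialHomeomorph H
  -- Restricting to the open set where the derivative is invertible makes the inverse smooth on the
  -- whole target.
  let O' : Set (ℂ × G) := O ∩ fderiv ℂ H ⁻¹' range ((↑) : ((ℂ × G) ≃L[ℂ] E) → (ℂ × G) →L[ℂ] E)
  have hO' : IsOpen O' := (hHs.continuousOn_fderiv_of_isOpen hO (by simp)).isOpen_inter_preimage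
    hO ContinuousLinearEquiv.isOpen
  have hsource : (h₀.restr O').source = h₀.source ∩ O' := h₀.restr_source' O' hO'
  have hder : ∀ p ∈ (h₀.restr O').source, ∃ L : (ℂ × G) ≃L[ℂ] E,
      HasFDerivAt (h₀.restr O') (L : (ℂ × G) →L[ℂ] E) p ∧ L (1, 0) = V (h₀.restr O' p) := by
    intro p hp
    rw [hsource] at hp
    obtain ⟨L, hL⟩ := hp.2.2
    refine ⟨L, ?_, ?_⟩
    · rw [hL]; exact hHF p hp.2.1
    · rw [← ContinuousLinearEquiv.coe_coe, hL]; exact htime p hp.2.1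
  refine ⟨h₀.restr O', ?_, hH0, ?_, ?_, ?_, hder⟩
  · rw [hsource]
    exact ⟨hstrict.mem_toOpenPartialHomeomorph_source, hO0, L₀, hL₀⟩
  · intro z hz
    have h1 := (h₀.restr O').map_target hz
    rw [hsource] at h1
    rw [← (h₀.restr O').right_inv hz]
    exact hum h1.2.1
  · exact hHs.mono fun p hp => (hsource ▸ hp).2.1
  · intro z hz
    have h1 := (h₀.restr O').map_target hz
    obtain ⟨L, hL, -⟩ := hder _ h1
    rw [hsource] at h1
    exact ((h₀.restr O').contDiffAt_symm hz hL
      (hHs.contDiffAt (hO.mem_nhds h1.2.1))).contDiffWithinAt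

/-- Near a point where it does not vanish, the kernel of a holomorphic 2-form on a
three-dimensional complex vector space is tangent to the plaques of a smooth chart. -/
theorem exists_flowBox (hE : Module.finrank ℂ E = 3)
    {β : E → E [⋀^Fin 2]→L[ℂ] ℂ} {U : Set E} (hU : IsOpen U) (hβ : DifferentiableOn ℂ β U)
    {z₀ : E} (hz₀ : z₀ ∈ U) (h0 : β z₀ ≠ 0) :
    ∃ ψ : OpenPartialHomeomorph E (EuclideanSpace ℝ (Fin 2) × EuclideanSpace ℝ (Fin 4)),
      z₀ ∈ ψ.source ∧ ψ.source ⊆ U ∧ ContDiffOn ℝ ∞ ψ ψ.source ∧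
      ContDiffOn ℝ ∞ ψ.symm ψ.target ∧ (∃ r : ℝ, ψ.target = ball 0 r ×ˢ ball 0 r) ∧
      ∀ z ∈ ψ.source, ∀ v : E,
        (∀ u, β z ![u, v] = 0) ↔ (fderiv ℝ ψ z v).2 = 0 := by
  obtain ⟨U', hU', hz₀', hUU', V, T, hV, hVT, hker⟩ :=
    exists_holomorphic_field_spanning_ker hE hU hβ hz₀ h0
  obtain ⟨h, hh0, hhz, hhU, hhs, hhsymm, hhd⟩ := exists_straightening hU' hV hz₀' T
    (by rw [hVT z₀ hz₀']; exact one_ne_zero)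
  let e : (ℂ × (ℂ × ℂ)) ≃L[ℝ] (EuclideanSpace ℝ (Fin 2) × EuclideanSpace ℝ (Fin 4)) :=
    (ContinuousLinearEquiv.ofFinrankEq (by simp)).prodCongr
      (ContinuousLinearEquiv.ofFinrankEq (by simp))
  have he2 : ∀ x, (e x).2 = 0 ↔ x.2 = 0 := fun x =>
    (ContinuousLinearEquiv.ofFinrankEq (𝕜 := ℝ) (E := ℂ × ℂ) (F := EuclideanSpace ℝ (Fin 4))
      (by simp)).map_eq_zero_iff
  let k₀ := e.symm.toHomeomorph.toOpenPartialHomeomorph.trans h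
  have hk₀s : k₀.source = e.symm ⁻¹' h.source := by simp [k₀]
  -- In the sup norm of the product a ball is a product of two balls of the same radius, as a
  -- foliation chart requires.
  obtain ⟨r, hr, hball⟩ := Metric.isOpen_iff.1 k₀.open_source 0 (by
    rw [hk₀s, mem_preimage, map_zero]; exact hh0)
  rw [← ball_prod_same] at hball
  change ball (0 : EuclideanSpace ℝ (Fin 2)) r ×ˢ ball (0 : EuclideanSpace ℝ (Fin 4)) r ⊆ _
    at hball
  have hopen : IsOpen (ball (0 : EuclideanSpace ℝ (Fin 2)) r ×ˢ
    ball (0 : EuclideanSpace ℝ (Fin 4)) r) := isOpen_ball.prod isOpen_ball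
  let k := k₀.restr (ball (0 : EuclideanSpace ℝ (Fin 2)) r ×ˢ ball (0 : EuclideanSpace ℝ (Fin 4)) r)
  have hks : k.source = ball (0 : EuclideanSpace ℝ (Fin 2)) r ×ˢ
      ball (0 : EuclideanSpace ℝ (Fin 4)) r := by
    rw [k₀.restr_source' _ hopen]
    exact inter_eq_right.2 hball
  have hksub : ∀ p ∈ k.source, e.symm p ∈ h.source := fun p hp => by
    rw [hks] at hp
    have := hball hp
    rwa [hk₀s] at this
  have hk : ∀ p, k p = h (e.symm p) := fun p => rfl
  have hksymm : ∀ z, k.symm z = e (h.symm z) := fun z => rfl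
  have hkt : k.target ⊆ h.target := fun z hz => by
    have h1 := k.map_target hz
    rw [← k.right_inv hz]
    exact h.map_source (hksub _ h1)
  refine ⟨k.symm, ?_, fun z hz => hUU' (hhU (hkt hz)), ?_, ?_, ⟨r, hks⟩, ?_⟩
  · have h1 : (0 : EuclideanSpace ℝ (Fin 2) × EuclideanSpace ℝ (Fin 4)) ∈ k.source := by
      rw [hks]; exact ⟨mem_ball_self hr, mem_ball_self hr⟩
    have h2 := k.map_source h1
    rwa [hk, map_zero, hhz] at h2
  · exact e.contDiff.comp_contDiffOn ((hhsymm.restrict_scalars ℝ).mono hkt)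
  · exact (hhs.restrict_scalars ℝ).comp e.symm.contDiff.contDiffOn hksub
  · intro z hz v
    have hzt : z ∈ h.target := hkt hz
    obtain ⟨L, hL, hLV⟩ := hhd _ (h.map_target hzt)
    rw [h.right_inv hzt] at hLV
    have h1 : HasFDerivAt k.symm ((e : _ →L[ℝ] _).comp
        ((L.symm : E →L[ℂ] (ℂ × (ℂ × ℂ))).restrictScalars ℝ)) z :=
      e.hasFDerivAt.comp z ((h.hasFDerivAt_symm hzt hL).restrictScalars ℝ)
    -- The inverse differential sends V to (1, 0), so the complex multiples of V are the vectors
    -- whose image has zero transverse part.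
    rw [hker z (hhU hzt), h1.fderiv]
    change _ ↔ (e (L.symm v)).2 = 0
    rw [he2, ← hLV]
    constructor
    · rintro ⟨c, rfl⟩
      rw [map_smul, L.symm_apply_apply]; simp
    · intro h2
      refine ⟨(L.symm v).1, ?_⟩
      rw [← map_smul, ← L.symm_apply_eq]
      exact Prod.ext (by simp) (by simpa using h2)

end Straightening

/-! ### Holomorphic 2-forms in charts -/

section HolomorphicCharts

open Metric Set Filter
open scoped Topology

variable {E : Type*} [NormedAddCommGroup E] [NormedSpace ℂ E]
  {X : Type*} [TopologicalSpace X] [ChartedSpace E X]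

/-- A complex manifold is a smooth real manifold. -/
theorem isManifold_real_of_complex [IsManifold 𝓘(ℂ, E) ω X] : IsManifold 𝓘(ℝ, E) ∞ X := by
  refine isManifold_of_contDiffOn _ _ _ fun e e' he he' => ?_
  have h := (contDiffGroupoid ω 𝓘(ℂ, E)).compatible he he'
  rw [contDiffGroupoid, mem_groupoid_of_pregroupoid] at h
  exact (h.1.restrict_scalars ℝ).of_le le_top

theorem HasMFDerivAt.restrictScalars_real {E' : Type*} [NormedAddCommGroup E'] [NormedSpace ℂ E']
    {X' : Type*} [TopologicalSpace X'] [ChartedSpace E' X'] {f : X → X'} {x : X}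
    {f' : E →L[ℂ] E'} (h : HasMFDerivAt 𝓘(ℂ, E) 𝓘(ℂ, E') f x f') :
    HasMFDerivAt 𝓘(ℝ, E) 𝓘(ℝ, E') f x (f'.restrictScalars ℝ) :=
  ⟨h.1, HasFDerivWithinAt.restrictScalars ℝ h.2⟩

/-- Nondegeneracy of the metric reduces `kEndo` to the real part of α; replacing u by iu recovers
the imaginary part. -/
theorem kEndo_eq_zero_iff [FiniteDimensional ℂ E] (w : KaehlerForm E X)
    (α : HolomorphicTwoForm E X) (x : X) (v : E) :
    kEndo w α x v = 0 ↔ ∀ u : E, α.form x ![u, v] = 0 := by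
  constructor
  · intro h u
    have hre : ∀ u : E, (α.form x ![u, v]).re = 0 := fun u => by
      rw [← metric_kEndo w α x u v, h, map_zero]
    refine Complex.ext (hre u) ?_
    have h1 := hre (Complex.I • u)
    have h2 : α.form x ![Complex.I • u, v] = Complex.I * α.form x ![u, v] :=
      alternating_two_smul_left (V := E) (α.form x) Complex.I u v
    rw [h2] at h1
    simpa using h1
  · intro h
    refine (w.metric_nondegenerate x).2 _ fun u => ?_
    refine (metric_kEndo w α x u v).trans ?_
    exact (congrArg Complex.re (h u)).trans Complex.zero_re

variable [IsManifold 𝓘(ℂ, E) ω X]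

theorem mdifferentiable_of_mem_atlas_complex {e : OpenPartialHomeomorph X E}
    (he : e ∈ atlas E X) : e.MDifferentiable 𝓘(ℂ, E) 𝓘(ℂ, E) := by
  have : IsManifold 𝓘(ℂ, E) 1 X := IsManifold.of_le (n := ω) le_top
  exact mdifferentiable_of_mem_atlas he

theorem form_eq_chartForm (α : HolomorphicTwoForm E X) {e : OpenPartialHomeomorph X E}
    (he : e ∈ atlas E X) {x : X} (hx : x ∈ e.source) (u v : E) :
    α.form x ![u, v] = chartForm α.form e (e x)
      ![mfderiv 𝓘(ℂ, E) 𝓘(ℂ, E) e x u, mfderiv 𝓘(ℂ, E) 𝓘(ℂ, E) e x v] := by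
  have h := (mdifferentiable_of_mem_atlas_complex he).symm_comp_deriv hx
  have h' : ∀ u : E, mfderiv 𝓘(ℂ, E) 𝓘(ℂ, E) e.symm (e x)
      (mfderiv 𝓘(ℂ, E) 𝓘(ℂ, E) e x u) = u := fun u => congrArg (fun L => L u) h
  have hx' := e.left_inv hx
  have key : ∀ y : X, y = x → α.form y ![u, v] = α.form x ![u, v] := by rintro _ rfl; rfl
  rw [← key _ hx']
  change _ = α.form (e.symm (e x)) _
  congr 1
  ext i
  fin_cases i
  · exact (h' u).symm
  · exact (h' v).symm

theorem mfderiv_chart_surjective {e : OpenPartialHomeomorph X E}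
    (he : e ∈ atlas E X) {x : X} (hx : x ∈ e.source) (u : E) :
    ∃ u' : E, (mfderiv 𝓘(ℂ, E) 𝓘(ℂ, E) e x u' : E) = u := by
  have h := (mdifferentiable_of_mem_atlas_complex he).comp_symm_deriv (e.map_source hx)
  rw [e.left_inv hx] at h
  exact ⟨_, congrArg (fun L => L u) h⟩

/-- The differential of a chart is bijective, so pulling back neither creates nor destroys zeros. -/
theorem chartForm_eq_zero_iff (α : HolomorphicTwoForm E X) {e : OpenPartialHomeomorph X E}
    (he : e ∈ atlas E X) {x : X} (hx : x ∈ e.source) :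
    chartForm α.form e (e x) = 0 ↔ α.form x = 0 := by
  constructor
  · intro h
    by_contra h0
    obtain ⟨u, v, huv⟩ := exists_alternating_two_ne_zero (V := E) h0
    refine huv ((form_eq_chartForm α he hx u v).trans ?_)
    rw [h]; rfl
  · intro h
    by_contra h0
    obtain ⟨u, v, huv⟩ := exists_alternating_two_ne_zero (V := E) h0
    obtain ⟨u', rfl⟩ := mfderiv_chart_surjective he hx u
    obtain ⟨v', rfl⟩ := mfderiv_chart_surjective he hx v
    refine huv ((form_eq_chartForm α he hx u' v').symm.trans ?_)
    rw [h]; rfl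

/-- Around each point where the holomorphic 2-form `α` does not vanish there is a smooth chart
whose plaques are tangent to the kernel of `K_α`. -/
theorem exists_flowBox_kEndo [FiniteDimensional ℂ E] (hE : Module.finrank ℂ E = 3)
    (w : KaehlerForm E X) (α : HolomorphicTwoForm E X) {p : X} (hp : α.form p ≠ 0) :
    ∃ φ : OpenPartialHomeomorph X (EuclideanSpace ℝ (Fin 2) × EuclideanSpace ℝ (Fin 4)),
      p ∈ φ.source ∧ φ.source ⊆ α.zeroLocusᶜ ∧
      ContMDiffOn 𝓘(ℝ, E) 𝓘(ℝ, EuclideanSpace ℝ (Fin 2) × EuclideanSpace ℝ (Fin 4)) ∞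
        φ φ.source ∧
      ContMDiffOn 𝓘(ℝ, EuclideanSpace ℝ (Fin 2) × EuclideanSpace ℝ (Fin 4)) 𝓘(ℝ, E) ∞
        φ.symm φ.target ∧
      (∃ r : ℝ, φ.target = ball 0 r ×ˢ ball 0 r) ∧
      ∀ x ∈ φ.source, ∀ v : TangentSpace 𝓘(ℝ, E) x, kEndo w α x v = 0 ↔
        mfderiv 𝓘(ℝ, E) 𝓘(ℝ, EuclideanSpace ℝ (Fin 4)) (fun y => (φ y).2) x v = 0 := by
  have := isManifold_real_of_complex (E := E) (X := X)
  set e := chartAt E p with he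
  have heA : e ∈ atlas E X := chart_mem_atlas E p
  have hpe : p ∈ e.source := mem_chart_source E p
  have hcont : ContinuousOn (chartForm α.form e) e.target :=
    (α.holomorphic e heA).continuousOn
  -- Removing the zeros of the chart expression makes the flow box avoid the zero locus.
  have hU : IsOpen (e.target ∩ chartForm α.form e ⁻¹' {0}ᶜ) :=
    hcont.isOpen_inter_preimage e.open_target isOpen_compl_singleton
  have hp0 : chartForm α.form e (e p) ≠ 0 := fun h => hp ((chartForm_eq_zero_iff α heA hpe).1 h)
  obtain ⟨ψ, hψp, hψU, hψs, hψsymm, hψt, hψker⟩ := exists_flowBox hE hU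
    ((α.holomorphic e heA).mono inter_subset_left) ⟨e.map_source hpe, hp0⟩ hp0
  have hsub : ∀ z ∈ ψ.source, z ∈ e.target := fun z hz => (hψU hz).1
  have hs : (e.trans ψ).source = e.source ∩ e ⁻¹' ψ.source := e.trans_source ψ
  have ht : (e.trans ψ).target = ψ.target := by
    rw [e.trans_target ψ]
    exact inter_eq_left.2 fun q hq => hsub _ (ψ.map_target hq)
  have hesmooth : ContMDiffOn 𝓘(ℝ, E) 𝓘(ℝ, E) ∞ e e.source := contMDiffOn_chart
  have hesymm : ContMDiffOn 𝓘(ℝ, E) 𝓘(ℝ, E) ∞ e.symm e.target := contMDiffOn_chart_symm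
  refine ⟨e.trans ψ, ?_, ?_, ?_, ?_, ?_, ?_⟩
  · rw [hs]; exact ⟨hpe, hψp⟩
  · intro x hx hx0
    rw [hs] at hx
    exact (hψU hx.2).2 ((chartForm_eq_zero_iff α heA hx.1).2 hx0)
  · rw [hs]
    exact hψs.contMDiffOn.comp (hesmooth.mono inter_subset_left) fun x hx => hx.2
  · rw [ht]
    exact hesymm.comp hψsymm.contMDiffOn fun q hq => hsub _ (ψ.map_target hq)
  · rw [ht]; exact hψt
  · intro x hx (v : E)
    rw [hs] at hx
    refine (kEndo_eq_zero_iff (E := E) w α x v).trans ?_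
    let D : E →L[ℂ] E := mfderiv 𝓘(ℂ, E) 𝓘(ℂ, E) e x
    have h1 := HasMFDerivAt.restrictScalars_real (f' := D)
        ((mdifferentiable_of_mem_atlas_complex heA).mdifferentiableAt hx.1).hasMFDerivAt
    have h2 : HasFDerivAt (fun z => (ψ z).2)
        ((ContinuousLinearMap.snd ℝ _ _).comp (fderiv ℝ ψ (e x))) (e x) :=
      (ContinuousLinearMap.snd ℝ (EuclideanSpace ℝ (Fin 2))
        (EuclideanSpace ℝ (Fin 4))).hasFDerivAt.comp (e x)
        ((hψs.differentiableOn (by simp)).differentiableAt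
          (ψ.open_source.mem_nhds hx.2)).hasFDerivAt
    have h3 := (h2.hasMFDerivAt.comp x h1).mfderiv
    change _ ↔ mfderiv 𝓘(ℝ, E) 𝓘(ℝ, EuclideanSpace ℝ (Fin 4)) ((fun z => (ψ z).2) ∘ e) x v = 0
    rw [h3]
    refine Iff.trans ?_ (hψker (e x) hx.2 (mfderiv 𝓘(ℂ, E) 𝓘(ℂ, E) e x v))
    constructor
    · intro h u
      obtain ⟨u', rfl⟩ := mfderiv_chart_surjective heA hx.1 u
      exact (form_eq_chartForm α heA hx.1 u' v).symm.trans (h u')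
    · intro h u
      exact (form_eq_chartForm α heA hx.1 u v).trans (h _)

end HolomorphicCharts

/-! ### Foliations from charts with compatible plaques -/

section PlaqueChains

open Metric Set Filter Relation
open scoped Topology

variable {X A B : Type*} [TopologicalSpace X] [TopologicalSpace A] [TopologicalSpace B]
  {ι : Type*} (φ : ι → OpenPartialHomeomorph X (A × B))

/-- The plaque of the chart `e` over `q`. -/
def plaque (e : OpenPartialHomeomorph X (A × B)) (q : B) : Set X := {x ∈ e.source | (e x).2 = q}

/-- Two points are related if they lie in a common plaque of one of the charts `φ i`. -/
def plaqueRel (x y : X) : Prop := ∃ i, ∃ q, x ∈ plaque (φ i) q ∧ y ∈ plaque (φ i) q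

/-- The leaf of `x`: the points that are joined to `x` by a chain of plaques. -/
def plaqueLeaf (x : X) : Set X := {y | ReflTransGen (plaqueRel φ) x y}

/-- The transverse coordinates of the points of `S` in the chart `e`. -/
def transversals (e : OpenPartialHomeomorph X (A × B)) (S : Set X) : Set B :=
  (fun x => (e x).2) '' (S ∩ e.source)

/-- The union of all plaques of the charts `φ i` that meet `S`. -/
def plaqueHull (S : Set X) : Set X := ⋃ i, ⋃ q ∈ transversals (φ i) S, plaque (φ i) q

variable {φ}

theorem plaqueRel_symm {x y : X} (h : plaqueRel φ x y) : plaqueRel φ y x := by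
  obtain ⟨i, q, hx, hy⟩ := h
  exact ⟨i, q, hy, hx⟩

theorem mem_plaqueLeaf_self (x : X) : x ∈ plaqueLeaf φ x := ReflTransGen.refl

theorem plaqueLeaf_symm {x y : X} (h : y ∈ plaqueLeaf φ x) : x ∈ plaqueLeaf φ y :=
  have : Std.Symm (plaqueRel φ) := ⟨fun _ _ => plaqueRel_symm⟩
  Std.Symm.symm (r := ReflTransGen (plaqueRel φ)) _ _ h

theorem plaqueLeaf_eq_of_mem {x y : X} (h : y ∈ plaqueLeaf φ x) :
    plaqueLeaf φ y = plaqueLeaf φ x :=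
  Subset.antisymm (fun _ hz => ReflTransGen.trans h hz)
    fun _ hz => ReflTransGen.trans (plaqueLeaf_symm h) hz

theorem plaque_subset_plaqueLeaf {i : ι} {q : B} {x : X} (hx : x ∈ plaque (φ i) q) :
    plaque (φ i) q ⊆ plaqueLeaf φ x := fun _ hy => ReflTransGen.single ⟨i, q, hx, hy⟩

theorem plaqueLeaf_subset {M : Set X} (hφ : ∀ i, (φ i).source ⊆ M) {x : X} (hx : x ∈ M) :
    plaqueLeaf φ x ⊆ M := by
  intro y hy
  induction hy with
  | refl => exact hx
  | tail _ h _ =>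
    obtain ⟨i, q, -, hz⟩ := h
    exact hφ i hz.1

/-- Consecutive plaques of a chain share a point, so their union is connected. -/
theorem isConnected_plaqueLeaf (hφ : ∀ i q, IsPreconnected (plaque (φ i) q)) (x : X) :
    IsConnected (plaqueLeaf φ x) := by
  refine ⟨⟨x, mem_plaqueLeaf_self x⟩, isPreconnected_of_forall x fun y hy => ?_⟩
  induction hy with
  | refl => exact ⟨{x}, singleton_subset_iff.2 (mem_plaqueLeaf_self x), rfl, rfl,
      isPreconnected_singleton⟩
  | @tail y z hy h ih =>
    obtain ⟨t, ht, hxt, hyt, htc⟩ := ih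
    obtain ⟨i, q, hyq, hzq⟩ := h
    refine ⟨t ∪ plaque (φ i) q, union_subset ht ?_, Or.inl hxt, Or.inr hzq,
      htc.union y hyt hyq (hφ i q)⟩
    rw [← plaqueLeaf_eq_of_mem hy]
    exact plaque_subset_plaqueLeaf hyq

/-- The hull consists of countably many plaques, each meeting a given chart in countably many
transverse coordinates. -/
theorem countable_transversals_plaqueHull [Countable ι]
    (hφ : ∀ i j q, (transversals (φ j) (plaque (φ i) q)).Countable) {S : Set X}
    (hS : ∀ i, (transversals (φ i) S).Countable) (j : ι) :
    (transversals (φ j) (plaqueHull φ S)).Countable := by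
  have h : transversals (φ j) (plaqueHull φ S) ⊆
      ⋃ i, ⋃ q ∈ transversals (φ i) S, transversals (φ j) (plaque (φ i) q) := by
    rintro _ ⟨x, ⟨hx, hxj⟩, rfl⟩
    simp only [plaqueHull, mem_iUnion] at hx ⊢
    obtain ⟨i, q, hq, hxq⟩ := hx
    exact ⟨i, q, hq, x, ⟨hxq, hxj⟩, rfl⟩
  exact (countable_iUnion fun i => (hS i).biUnion fun q _ => hφ i j q).mono h

/-- A chain of n plaques from x ends in the n-th iterated hull of {x}; countability passes to each
iterate and to their union. -/
theorem countable_transversals_plaqueLeaf [Countable ι]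
    (hφ : ∀ i j q, (transversals (φ j) (plaque (φ i) q)).Countable) (x : X) (j : ι) :
    (transversals (φ j) (plaqueLeaf φ x)).Countable := by
  have hn : ∀ n : ℕ, ∀ i, (transversals (φ i) ((plaqueHull φ)^[n] {x})).Countable := by
    intro n
    induction n with
    | zero => exact fun i => ((countable_singleton x).mono inter_subset_left).image _
    | succ n ih =>
      rw [Function.iterate_succ_apply']
      exact countable_transversals_plaqueHull hφ ih
  have hsub : plaqueLeaf φ x ⊆ ⋃ n : ℕ, (plaqueHull φ)^[n] {x} := by
    intro y hy
    induction hy with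
    | refl => exact mem_iUnion.2 ⟨0, rfl⟩
    | tail _ h ih =>
      obtain ⟨n, hn⟩ := mem_iUnion.1 ih
      obtain ⟨i, q, hy, hz⟩ := h
      refine mem_iUnion.2 ⟨n + 1, ?_⟩
      rw [Function.iterate_succ_apply']
      exact mem_iUnion.2 ⟨i, mem_iUnion₂.2 ⟨q, ⟨_, ⟨hn, hy.1⟩, hy.2⟩, hz⟩⟩
  refine (countable_iUnion fun n => hn n j).mono ?_
  rintro _ ⟨y, ⟨hy, hyj⟩, rfl⟩
  obtain ⟨n, hn⟩ := mem_iUnion.1 (hsub hy)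
  exact mem_iUnion.2 ⟨n, y, ⟨hn, hyj⟩, rfl⟩

end PlaqueChains

/-! ### Plaques as connected components. -/

section PlaqueComponents

open Metric Set

variable {X A B : Type*} [TopologicalSpace X] [TopologicalSpace A] [MetricSpace B]
  {e : OpenPartialHomeomorph X (A × B)}

theorem symm_image_eq_plaque {W₁ : Set A} {W₂ : Set B} (he : e.target = W₁ ×ˢ W₂) {q : B}
    (hq : q ∈ W₂) : e.symm '' (W₁ ×ˢ {q}) = plaque e q := by
  ext x
  constructor
  · rintro ⟨⟨a, b⟩, ⟨ha, hb⟩, rfl⟩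
    obtain rfl : b = q := hb
    have hab : (a, b) ∈ e.target := he ▸ ⟨ha, hq⟩
    exact ⟨e.map_target hab, by rw [e.right_inv hab]⟩
  · rintro ⟨hx, rfl⟩
    have := e.map_source hx
    rw [he] at this
    exact ⟨e x, ⟨this.1, rfl⟩, e.left_inv hx⟩

theorem isPreconnected_plaque {W₁ : Set A} {W₂ : Set B} (he : e.target = W₁ ×ˢ W₂)
    (hW : IsPreconnected W₁) (q : B) : IsPreconnected (plaque e q) := by
  by_cases hq : q ∈ W₂
  · rw [← symm_image_eq_plaque he hq]
    refine (hW.prod isPreconnected_singleton).image _ (e.continuousOn_symm.mono ?_)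
    rw [he]
    exact prod_mono_right (singleton_subset_iff.2 hq)
  · convert! isPreconnected_empty
    refine eq_empty_of_forall_notMem fun x hx => hq ?_
    have := e.map_source hx.1
    rw [he] at this
    exact hx.2 ▸ this.2

/-- A plaque is a connected component of the part in `e.source` of a set that meets only countably
many plaques. -/
theorem plaque_eq_connectedComponentIn {q : B} (hc : IsPreconnected (plaque e q))
    {L : Set X} {x : X} (hx : x ∈ plaque e q) (hL : plaque e q ⊆ L)
    (hcount : (transversals e L).Countable) :
    plaque e q = connectedComponentIn (e.source ∩ L) x := by
  have hxL : x ∈ e.source ∩ L := ⟨hx.1, hL hx⟩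
  refine Subset.antisymm (hc.subset_connectedComponentIn hx fun y hy => ⟨hy.1, hL hy⟩) ?_
  intro y hy
  have hsub := connectedComponentIn_subset (e.source ∩ L) x
  have himage : IsPreconnected ((fun z => (e z).2) '' connectedComponentIn (e.source ∩ L) x) := by
    refine isPreconnected_connectedComponentIn.image _ ?_
    exact continuous_snd.comp_continuousOn (e.continuousOn.mono fun z hz => (hsub hz).1)
  -- The image of the component is connected and countable in a metric space, hence a point: the
  -- component stays in one plaque.
  have hss := hcount.isTotallyDisconnected _ (image_subset_iff.2 fun z hz =>
    ⟨z, ⟨(hsub hz).2, (hsub hz).1⟩, rfl⟩) himage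
  exact ⟨(hsub hy).1, (hss (mem_image_of_mem _ hy)
    (mem_image_of_mem _ (mem_connectedComponentIn hxL))).trans hx.2⟩

end PlaqueComponents

/-! ### Locally constant functions. -/

section LocallyConstant

open Metric Set Filter
open scoped Topology

theorem eventually_eq_of_fderiv_eq_zero {A B : Type*} [NormedAddCommGroup A] [NormedSpace ℝ A]
    [NormedAddCommGroup B] [NormedSpace ℝ B] {h : A → B} {a : A}
    (hd : ∀ᶠ x in 𝓝 a, HasFDerivAt h (0 : A →L[ℝ] B) x) : ∀ᶠ x in 𝓝 a, h x = h a := by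
  obtain ⟨r, hr, hball⟩ := Metric.eventually_nhds_iff_ball.1 hd
  filter_upwards [ball_mem_nhds a hr] with x hx
  exact isOpen_ball.is_const_of_fderiv_eq_zero (convex_ball a r).isPreconnected
    (fun y hy => (hball y hy).differentiableAt.differentiableWithinAt)
    (fun y hy => (hball y hy).fderiv) hx (mem_ball_self hr)

/-- By second countability, countably many of the neighbourhoods of constancy cover O. -/
theorem countable_image_of_eventually_eq {A B : Type*} [TopologicalSpace A]
    [SecondCountableTopology A] {h : A → B} {O : Set A}
    (hc : ∀ a ∈ O, ∀ᶠ x in 𝓝 a, h x = h a) : (h '' O).Countable := by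
  obtain ⟨t, -, ht, hcov⟩ := TopologicalSpace.countable_cover_nhdsWithin (s := O)
    (f := fun a => {x | h x = h a}) fun a ha => mem_nhdsWithin_of_mem_nhds (hc a ha)
  refine (ht.image h).mono ?_
  rintro _ ⟨x, hx, rfl⟩
  obtain ⟨a, ha, hxa⟩ := mem_iUnion₂.1 (hcov hx)
  exact ⟨a, ha, hxa.symm⟩

end LocallyConstant

/-! ### The foliation generated by plaque charts. -/

section FoliationOfDistribution

open Metric Set Filter
open scoped Topology

variable {E : Type*} [NormedAddCommGroup E] [NormedSpace ℝ E]
  {X : Type*} [TopologicalSpace X] [ChartedSpace E X] {m k : ℕ}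

/-- A smooth chart onto a product of disks, with plaques tangent to the distribution `D`. -/
structure IsPlaqueChart (M : Set X) (D : ∀ x : X, Submodule ℝ (TangentSpace 𝓘(ℝ, E) x))
    (φ : OpenPartialHomeomorph X (EuclideanSpace ℝ (Fin m) × EuclideanSpace ℝ (Fin k))) :
    Prop where
  source_subset : φ.source ⊆ M
  contMDiffOn : ContMDiffOn 𝓘(ℝ, E)
    𝓘(ℝ, EuclideanSpace ℝ (Fin m) × EuclideanSpace ℝ (Fin k)) ∞ φ φ.source
  contMDiffOn_symm : ContMDiffOn 𝓘(ℝ, EuclideanSpace ℝ (Fin m) × EuclideanSpace ℝ (Fin k))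
    𝓘(ℝ, E) ∞ φ.symm φ.target
  target_eq : ∃ r : ℝ, φ.target = ball 0 r ×ˢ ball 0 r
  mem_iff : ∀ x ∈ φ.source, ∀ v : TangentSpace 𝓘(ℝ, E) x,
    v ∈ D x ↔ mfderiv 𝓘(ℝ, E) 𝓘(ℝ, EuclideanSpace ℝ (Fin k)) (fun y => (φ y).2) x v = 0

variable {M : Set X} {D : ∀ x : X, Submodule ℝ (TangentSpace 𝓘(ℝ, E) x)}
  {φ φ' : OpenPartialHomeomorph X (EuclideanSpace ℝ (Fin m) × EuclideanSpace ℝ (Fin k))}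

theorem mdifferentiableAt_snd_chart (hφ : ContMDiffOn 𝓘(ℝ, E)
      𝓘(ℝ, EuclideanSpace ℝ (Fin m) × EuclideanSpace ℝ (Fin k)) ∞ φ φ.source)
    {x : X} (hx : x ∈ φ.source) :
    MDifferentiableAt 𝓘(ℝ, E) 𝓘(ℝ, EuclideanSpace ℝ (Fin k)) (fun y => (φ y).2) x := by
  have h1 := (hφ.contMDiffAt (φ.open_source.mem_nhds hx)).mdifferentiableAt (by simp)
  have h2 : MDifferentiableAt 𝓘(ℝ, EuclideanSpace ℝ (Fin m) × EuclideanSpace ℝ (Fin k))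
    𝓘(ℝ, EuclideanSpace ℝ (Fin k)) Prod.snd (φ x) :=
    differentiableAt_snd.mdifferentiableAt
  exact h2.comp x h1

/-- The transverse coordinate of one plaque chart is locally constant along the plaques of
another. -/
theorem IsPlaqueChart.hasFDerivAt_transverse (h : IsPlaqueChart M D φ) (h' : IsPlaqueChart M D φ')
    {a : EuclideanSpace ℝ (Fin m)} {q : EuclideanSpace ℝ (Fin k)} (ha : (a, q) ∈ φ.target)
    (ha' : φ.symm (a, q) ∈ φ'.source) :
    HasFDerivAt (fun b => (φ' (φ.symm (b, q))).2) (0 : EuclideanSpace ℝ (Fin m) →L[ℝ] _) a := by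
  have h1 : MDifferentiableAt 𝓘(ℝ, EuclideanSpace ℝ (Fin m)) 𝓘(ℝ, E)
      (fun b => φ.symm (b, q)) a := by
    have h2 := (h.contMDiffOn_symm.contMDiffAt
      (φ.open_target.mem_nhds ha)).mdifferentiableAt (by simp)
    have h3 : MDifferentiableAt 𝓘(ℝ, EuclideanSpace ℝ (Fin m))
        𝓘(ℝ, EuclideanSpace ℝ (Fin m) × EuclideanSpace ℝ (Fin k)) (fun b => (b, q)) a :=
      (differentiableAt_id.prodMk (differentiableAt_const q)).mdifferentiableAt
    exact h2.comp a h3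
  -- The transverse coordinate of φ is constant on its own plaque, so the velocities of the plaque
  -- lie in D, which is also the kernel of the transverse derivative of φ'.
  have hsnd := (mdifferentiableAt_snd_chart h.contMDiffOn (φ.map_target ha)).hasMFDerivAt.comp a
    h1.hasMFDerivAt
  have hconst : HasMFDerivAt 𝓘(ℝ, EuclideanSpace ℝ (Fin m)) 𝓘(ℝ, EuclideanSpace ℝ (Fin k))
      ((fun y => (φ y).2) ∘ fun b => φ.symm (b, q)) a
      (0 : EuclideanSpace ℝ (Fin m) →L[ℝ] EuclideanSpace ℝ (Fin k)) := by
    refine (hasMFDerivAt_const q a).congr_of_eventuallyEq ?_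
    have hnear : (fun b => ((b, q) : EuclideanSpace ℝ (Fin m) × EuclideanSpace ℝ (Fin k))) ⁻¹'
        φ.target ∈ 𝓝 a := (φ.open_target.preimage (by fun_prop)).mem_nhds ha
    filter_upwards [hnear] with b hb
    simp only [Function.comp_apply]
    rw [φ.right_inv hb]
  have hzero := hasMFDerivAt_unique hsnd hconst
  have hmain := (mdifferentiableAt_snd_chart h'.contMDiffOn ha').hasMFDerivAt.comp a
    h1.hasMFDerivAt
  have : HasMFDerivAt 𝓘(ℝ, EuclideanSpace ℝ (Fin m)) 𝓘(ℝ, EuclideanSpace ℝ (Fin k))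
      ((fun y => (φ' y).2) ∘ fun b => φ.symm (b, q)) a
      (0 : EuclideanSpace ℝ (Fin m) →L[ℝ] EuclideanSpace ℝ (Fin k)) := by
    refine hmain.congr_mfderiv (ContinuousLinearMap.ext fun v => ?_)
    exact ((h'.mem_iff _ ha' _).1 ((h.mem_iff _ (φ.map_target ha) _).2
      (congrArg (fun L => L v) hzero)))
  exact this.hasFDerivAt

/-- A plaque of φ may meet the domain of φ' in a disconnected set, so the locally constant
transverse coordinate of φ' need not be constant there; it still takes only countably many values.
-/
theorem IsPlaqueChart.countable_transversals (h : IsPlaqueChart M D φ)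
    (h' : IsPlaqueChart M D φ') (q : EuclideanSpace ℝ (Fin k)) :
    (transversals φ' (plaque φ q)).Countable := by
  let O : Set (EuclideanSpace ℝ (Fin m)) :=
    {a | (a, q) ∈ φ.target ∩ φ.symm ⁻¹' φ'.source}
  have hO : IsOpen O := (φ.continuousOn_symm.isOpen_inter_preimage φ.open_target
    φ'.open_source).preimage (by fun_prop)
  have hcount : ((fun b => (φ' (φ.symm (b, q))).2) '' O).Countable := by
    refine countable_image_of_eventually_eq fun a ha => eventually_eq_of_fderiv_eq_zero ?_
    filter_upwards [hO.mem_nhds ha] with b hb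
    exact h.hasFDerivAt_transverse h' hb.1 hb.2
  refine hcount.mono ?_
  rintro _ ⟨x, ⟨⟨hx, rfl⟩, hx'⟩, rfl⟩
  refine ⟨(φ x).1, ⟨φ.map_source hx, ?_⟩, ?_⟩
  · change φ.symm (φ x) ∈ φ'.source
    rwa [φ.left_inv hx]
  · change (φ' (φ.symm (φ x))).2 = _
    rw [φ.left_inv hx]

/-- A distribution that is tangent to the plaques of smooth charts induces a foliation. -/
theorem exists_isFoliationOf [SecondCountableTopology X]
    (hM : ∀ p ∈ M, ∃ φ : OpenPartialHomeomorph X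
      (EuclideanSpace ℝ (Fin m) × EuclideanSpace ℝ (Fin k)),
      p ∈ φ.source ∧ IsPlaqueChart M D φ) :
    ∃ F : Set (Set X), IsFoliationOf m k M D F := by
  have hM' : ∀ p : M, ∃ φ : OpenPartialHomeomorph X
      (EuclideanSpace ℝ (Fin m) × EuclideanSpace ℝ (Fin k)),
      (p : X) ∈ φ.source ∧ IsPlaqueChart M D φ := fun p => hM p p.2
  choose φ₀ hp hφ₀ using hM'
  -- Countably many charts suffice, which is what keeps the transverse coordinates of a leaf
  -- countable.
  obtain ⟨t, ht, hcov⟩ := TopologicalSpace.countable_cover_nhds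
    (f := fun p : M => ((↑) : M → X) ⁻¹' (φ₀ p).source) fun p =>
      ((φ₀ p).open_source.preimage continuous_subtype_val).mem_nhds (hp p)
  have : Countable t := ht.to_subtype
  let φ : t → OpenPartialHomeomorph X
    (EuclideanSpace ℝ (Fin m) × EuclideanSpace ℝ (Fin k)) := fun i => φ₀ i
  have hφ : ∀ i, IsPlaqueChart M D (φ i) := fun i => hφ₀ i
  have hcover : ∀ p ∈ M, ∃ i, p ∈ (φ i).source := by
    intro p hpM
    have h : (⟨p, hpM⟩ : M) ∈ ⋃ x ∈ t, ((↑) : M → X) ⁻¹' (φ₀ x).source := hcov ▸ mem_univ _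
    obtain ⟨i, hi, h⟩ := mem_iUnion₂.1 h
    exact ⟨⟨i, hi⟩, h⟩
  have hpre : ∀ i q, IsPreconnected (plaque (φ i) q) := fun i q => by
    obtain ⟨r, hr⟩ := (hφ i).target_eq
    exact isPreconnected_plaque hr (convex_ball _ _).isPreconnected q
  have hcount := countable_transversals_plaqueLeaf (φ := φ) fun i j q =>
    (hφ i).countable_transversals (hφ j) q
  have hsub : ∀ i, (φ i).source ⊆ M := fun i => (hφ i).source_subset
  have hchart : ∀ i, IsFoliationChart (E := E) m k M (plaqueLeaf φ '' M) (φ i) := by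
    intro i
    refine ⟨hsub i, (hφ i).contMDiffOn, (hφ i).contMDiffOn_symm, ?_⟩
    obtain ⟨r, hr⟩ := (hφ i).target_eq
    refine ⟨0, 0, r, r, hr, fun q hq => ?_⟩
    have hr0 : 0 < r := pos_of_mem_ball hq
    have hx : (φ i).symm (0, q) ∈ plaque (φ i) q := by
      rw [← symm_image_eq_plaque hr hq]
      exact mem_image_of_mem _ ⟨mem_ball_self hr0, rfl⟩
    refine ⟨plaqueLeaf φ ((φ i).symm (0, q)), mem_image_of_mem _ (hsub i hx.1),
      (φ i).symm (0, q), ⟨hx.1, mem_plaqueLeaf_self _⟩, ?_⟩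
    rw [symm_image_eq_plaque hr hq]
    exact plaque_eq_connectedComponentIn (hpre i q) hx (plaque_subset_plaqueLeaf hx)
      (hcount _ i)
  refine ⟨plaqueLeaf φ '' M, ⟨⟨?_, ?_, ?_, fun p hpM => ?_⟩, fun p hpM => ?_⟩⟩
  · rintro _ ⟨x, -, rfl⟩
    exact isConnected_plaqueLeaf hpre x
  · refine Subset.antisymm (sUnion_subset ?_) fun x hx =>
      ⟨_, mem_image_of_mem _ hx, mem_plaqueLeaf_self x⟩
    rintro _ ⟨x, hx, rfl⟩
    exact plaqueLeaf_subset hsub hx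
  · rintro _ ⟨x, -, rfl⟩ _ ⟨y, -, rfl⟩ hne
    refine disjoint_left.2 fun z hz hz' => hne ?_
    exact (plaqueLeaf_eq_of_mem hz).symm.trans (plaqueLeaf_eq_of_mem hz')
  · obtain ⟨i, hi⟩ := hcover p hpM
    exact ⟨φ i, hi, hchart i⟩
  · obtain ⟨i, hi⟩ := hcover p hpM
    exact ⟨φ i, hi, hchart i, (hφ i).mem_iff⟩

end FoliationOfDistribution

/-! ### Curves tangent to a foliation -/

section Connectedness

open Metric Set Filter
open scoped Topology

/-- A preconnected set covered by disjoint open sets lies in one of them. -/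
theorem IsPreconnected.exists_subset_of_pairwise_disjoint {N κ : Type*} [TopologicalSpace N]
    {F : Set κ} {A : κ → Set N} (hA : ∀ L ∈ F, IsOpen (A L))
    (hd : ∀ L ∈ F, ∀ L' ∈ F, ∀ x, x ∈ A L → x ∈ A L' → L = L') {S : Set N}
    (hS : IsPreconnected S) (hne : S.Nonempty) (hcov : ∀ x ∈ S, ∃ L ∈ F, x ∈ A L) :
    ∃ L ∈ F, S ⊆ A L := by
  obtain ⟨x₀, hx₀⟩ := hne
  obtain ⟨L₀, hL₀, hxL₀⟩ := hcov x₀ hx₀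
  refine ⟨L₀, hL₀, hS.subset_left_of_subset_union (v := ⋃ L ∈ F \ {L₀}, A L) (hA L₀ hL₀)
    (isOpen_biUnion fun L hL => hA L hL.1) ?_ ?_ ⟨x₀, hx₀, hxL₀⟩⟩
  · rw [Set.disjoint_left]
    intro x hx hx'
    obtain ⟨L, hL, hxL⟩ := mem_iUnion₂.1 hx'
    exact hL.2 (hd L hL.1 L₀ hL₀ x hxL hx)
  · intro x hx
    obtain ⟨L, hL, hxL⟩ := hcov x hx
    by_cases h : L = L₀
    · exact Or.inl (h ▸ hxL)
    · exact Or.inr (mem_iUnion₂.2 ⟨L, ⟨hL, h⟩, hxL⟩)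

/-- At a point y ≠ p, punctured neighbourhoods of p restrict to full neighbourhoods of y, because
{p} is closed. -/
theorem isOpen_setOf_eventually_nhdsNE {N : Type*} [TopologicalSpace N] [T1Space N] (P : N → Prop) :
    IsOpen {p | ∀ᶠ q in 𝓝[≠] p, P q} := by
  rw [isOpen_iff_eventually]
  intro p hp
  have h1 : ∀ᶠ y in 𝓝[≠] p, ∀ᶠ q in 𝓝 y, P q := by
    filter_upwards [eventually_eventually_nhdsWithin.2 hp, self_mem_nhdsWithin] with y hy hyp
    rwa [isOpen_compl_singleton.nhdsWithin_eq hyp] at hy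
  rw [eventually_nhdsWithin_iff] at h1
  filter_upwards [h1] with y hy
  by_cases h : y = p
  · exact h ▸ hp
  · exact (hy h).filter_mono nhdsWithin_le_nhds

/-- Polar coordinates present the punctured disc as the image of an interval times a circle. -/
theorem isConnected_ball_diff_center (c : ℂ) {r : ℝ} (hr : 0 < r) :
    IsConnected (ball c r \ {c}) := by
  have h1 : IsConnected (Ioo 0 r ×ˢ sphere (0 : ℂ) 1) :=
    (isConnected_Ioo hr).prod (isConnected_sphere (by simp) 0 zero_le_one)
  have h2 := h1.image (fun x : ℝ × ℂ => c + (x.1 : ℂ) * x.2) (by fun_prop)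
  convert h2 using 1
  ext z
  constructor
  · rintro ⟨hz, hzc⟩
    have hzc' : z - c ≠ 0 := sub_ne_zero.2 hzc
    have hpos : 0 < ‖z - c‖ := norm_pos_iff.2 hzc'
    refine ⟨(‖z - c‖, (z - c) / ‖z - c‖), ⟨⟨hpos, mem_ball_iff_norm.1 hz⟩, ?_⟩, ?_⟩
    · simp [hpos.ne']
    · have : ((‖z - c‖ : ℝ) : ℂ) ≠ 0 := by exact_mod_cast hpos.ne'
      simp only
      field_simp
      ring
  · rintro ⟨⟨t, u⟩, ⟨⟨ht0, htr⟩, hu⟩, rfl⟩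
    have hu1 : ‖u‖ = 1 := by simpa using hu
    have hn : ‖(t : ℂ) * u‖ = t := by simp [hu1, abs_of_pos ht0]
    refine ⟨by simpa [mem_ball_iff_norm, hu1, abs_of_pos ht0] using htr, fun h => ?_⟩
    have h0 : (t : ℂ) * u = 0 := by simpa using h
    rw [h0, norm_zero] at hn
    exact ht0.ne hn

variable {N : Type*} [TopologicalSpace N] [ChartedSpace ℂ N]

/-- Punctured neighbourhoods in a Riemann surface contain connected punctured neighbourhoods. -/
theorem exists_isConnected_mem_nhdsNE {p : N} {O : Set N} (hO : O ∈ 𝓝[≠] p) :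
    ∃ U ∈ 𝓝[≠] p, U ⊆ O ∧ IsConnected U := by
  set c := chartAt ℂ p with hc
  have hp : p ∈ c.source := mem_chart_source ℂ p
  obtain ⟨O', hO', hOO'⟩ := mem_nhdsWithin_iff_exists_mem_nhds_inter.1 hO
  have h1 : c.target ∩ c.symm ⁻¹' O' ∈ 𝓝 (c p) := by
    refine inter_mem (c.open_target.mem_nhds (c.map_source hp)) ?_
    refine (c.continuousAt_symm (c.map_source hp)).preimage_mem_nhds ?_
    rwa [c.left_inv hp]
  obtain ⟨r, hr, hball⟩ := Metric.mem_nhds_iff.1 h1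
  refine ⟨c.symm '' (ball (c p) r \ {c p}), ?_, ?_, (isConnected_ball_diff_center _ hr).image _
    (c.continuousOn_symm.mono fun z hz => (hball hz.1).1)⟩
  · rw [mem_nhdsWithin_iff_exists_mem_nhds_inter]
    refine ⟨c.source ∩ c ⁻¹' ball (c p) r, inter_mem (c.open_source.mem_nhds hp)
      ((c.continuousAt hp).preimage_mem_nhds (ball_mem_nhds _ hr)), ?_⟩
    rintro q ⟨⟨hq, hqr⟩, hqp⟩
    exact ⟨c q, ⟨hqr, fun h => hqp (c.injOn hq hp h)⟩, c.left_inv hq⟩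
  · rintro _ ⟨z, ⟨hz, hzp⟩, rfl⟩
    refine hOO' ⟨(hball hz).2, fun h => hzp ?_⟩
    have h2 : c.symm z = p := h
    rw [mem_singleton_iff, ← h2, c.right_inv (hball hz).1]

/-- Lets two properties that hold on punctured neighbourhoods of a point be compared at a common
point. -/
theorem nhdsNE_neBot_of_chartedSpace_complex (p : N) : (𝓝[≠] p).NeBot := by
  rw [neBot_iff, Ne, ← empty_mem_iff_bot]
  intro h
  obtain ⟨U, -, hU, hne, -⟩ := exists_isConnected_mem_nhdsNE h
  exact hne.ne_empty (subset_empty_iff.1 hU)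

end Connectedness

/-! ### Maps tangent to a foliation. -/

section TangentCurves

open Metric Set Filter
open scoped Topology

variable {E : Type*} [NormedAddCommGroup E] [NormedSpace ℝ E]
  {X : Type*} [TopologicalSpace X] [ChartedSpace E X] {m k : ℕ} {M : Set X}
  {D : ∀ x : X, Submodule ℝ (TangentSpace 𝓘(ℝ, E) x)} {F : Set (Set X)}

theorem IsFoliation.eq_of_mem (hF : IsFoliation E m k M F) {L L' : Set X} (hL : L ∈ F)
    (hL' : L' ∈ F) {x : X} (hx : x ∈ L) (hx' : x ∈ L') : L = L' := by
  by_contra h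
  exact Set.disjoint_left.1 (hF.pairwiseDisjoint hL hL' h) hx hx'

theorem IsFoliationChart.exists_plaque_subset
    {φ : OpenPartialHomeomorph X (EuclideanSpace ℝ (Fin m) × EuclideanSpace ℝ (Fin k))}
    (hφ : IsFoliationChart (E := E) m k M F φ) {x : X} (hx : x ∈ φ.source) :
    ∃ L ∈ F, plaque φ (φ x).2 ⊆ L := by
  obtain ⟨a, b, r, s, ht, h⟩ := hφ.plaques
  have hq : (φ x).2 ∈ ball b s := by
    have := φ.map_source hx
    rw [ht] at this
    exact this.2
  obtain ⟨L, hL, y, -, hy⟩ := h _ hq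
  refine ⟨L, hL, ?_⟩
  rw [← symm_image_eq_plaque ht hq, hy]
  exact (connectedComponentIn_subset _ _).trans inter_subset_right

theorem eventually_eq_of_mfderiv_eq_zero {G B : Type*} [NormedAddCommGroup G] [NormedSpace ℝ G]
    [NormedAddCommGroup B] [NormedSpace ℝ B] {N : Type*} [TopologicalSpace N] [ChartedSpace G N]
    [IsManifold 𝓘(ℝ, G) 1 N] {h : N → B} {p : N}
    (hd : ∀ᶠ q in 𝓝 p, HasMFDerivAt 𝓘(ℝ, G) 𝓘(ℝ, B) h q (0 : G →L[ℝ] B)) :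
    ∀ᶠ q in 𝓝 p, h q = h p := by
  set c := chartAt G p with hc
  have hp : p ∈ c.source := mem_chart_source G p
  have hcm : c.MDifferentiable 𝓘(ℝ, G) 𝓘(ℝ, G) :=
    mdifferentiable_of_mem_atlas (chart_mem_atlas G p)
  have hsymm : Tendsto c.symm (𝓝 (c p)) (𝓝 p) := by
    have := (c.continuousAt_symm (c.map_source hp)).tendsto
    rwa [c.left_inv hp] at this
  have h1 : ∀ᶠ z in 𝓝 (c p), HasFDerivAt (h ∘ c.symm) (0 : G →L[ℝ] B) z := by
    filter_upwards [hsymm.eventually hd, c.open_target.mem_nhds (c.map_source hp)] with z hz hzt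
    have h2 := hz.comp z (hcm.mdifferentiableAt_symm hzt).hasMFDerivAt
    have h3 : HasMFDerivAt 𝓘(ℝ, G) 𝓘(ℝ, B) (h ∘ c.symm) z (0 : G →L[ℝ] B) :=
      h2.congr_mfderiv (ContinuousLinearMap.ext fun v => rfl)
    exact h3.hasFDerivAt
  have h4 := eventually_eq_of_fderiv_eq_zero h1
  filter_upwards [(c.continuousAt hp).eventually h4, c.open_source.mem_nhds hp] with q hq hqs
  simpa [c.left_inv hqs, c.left_inv hp] using hq

/-- A map tangent to the leaves of a foliation is locally contained in a leaf. -/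
theorem IsFoliationOf.exists_leaf_eventually {G : Type*} [NormedAddCommGroup G] [NormedSpace ℝ G]
    {N : Type*} [TopologicalSpace N] [ChartedSpace G N] [IsManifold 𝓘(ℝ, G) 1 N]
    (hF : IsFoliationOf m k M D F) {g : N → X} (hg : MDifferentiable 𝓘(ℝ, G) 𝓘(ℝ, E) g)
    (hgD : ∀ q v, mfderiv 𝓘(ℝ, G) 𝓘(ℝ, E) g q v ∈ D (g q)) {p : N} (hp : g p ∈ M) :
    ∃ L ∈ F, ∀ᶠ q in 𝓝 p, g q ∈ L := by
  obtain ⟨φ, hpφ, hφ, hD⟩ := hF.tangent _ hp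
  obtain ⟨L, hL, hsub⟩ := hφ.exists_plaque_subset hpφ
  have hnear : ∀ᶠ q in 𝓝 p, g q ∈ φ.source :=
    hg.continuous.continuousAt.eventually (φ.open_source.mem_nhds hpφ)
  have hd : ∀ᶠ q in 𝓝 p, HasMFDerivAt 𝓘(ℝ, G) 𝓘(ℝ, EuclideanSpace ℝ (Fin k))
      ((fun y => (φ y).2) ∘ g) q (0 : G →L[ℝ] EuclideanSpace ℝ (Fin k)) := by
    filter_upwards [hnear] with q hq
    refine ((mdifferentiableAt_snd_chart hφ.contMDiffOn hq).hasMFDerivAt.comp q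
      (hg q).hasMFDerivAt).congr_mfderiv (ContinuousLinearMap.ext fun v => ?_)
    exact (hD _ hq _).1 (hgD q v)
  refine ⟨L, hL, ?_⟩
  filter_upwards [hnear, eventually_eq_of_mfderiv_eq_zero hd] with q hq hq'
  exact hsub ⟨hq, hq'⟩

variable {N : Type*} [TopologicalSpace N] [ChartedSpace ℂ N] [IsManifold 𝓘(ℝ, ℂ) 1 N]
  {g : N → X}

/-- The point g(p) itself may lie outside M. The leaf is locally constant on a punctured disc, which
is connected, so the same leaf occurs all around p. -/
theorem IsFoliationOf.exists_leaf_eventually_nhdsNE (hF : IsFoliationOf m k M D F)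
    (hg : MDifferentiable 𝓘(ℝ, ℂ) 𝓘(ℝ, E) g)
    (hgD : ∀ q v, mfderiv 𝓘(ℝ, ℂ) 𝓘(ℝ, E) g q v ∈ D (g q)) {p : N}
    (hp : ∀ᶠ q in 𝓝[≠] p, g q ∈ M) :
    ∃ L ∈ F, ∀ᶠ q in 𝓝[≠] p, g q ∈ L := by
  obtain ⟨U, hU, hUM, hUc⟩ := exists_isConnected_mem_nhdsNE hp
  obtain ⟨L, hL, hsub⟩ := hUc.isPreconnected.exists_subset_of_pairwise_disjoint
    (A := fun L => interior (g ⁻¹' L)) (fun L _ => isOpen_interior)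
    (fun L hL L' hL' x hx hx' => hF.eq_of_mem (x := g x) hL hL'
      (interior_subset (s := g ⁻¹' L) hx) (interior_subset (s := g ⁻¹' L') hx'))
    hUc.nonempty fun x hx => by
      obtain ⟨L, hL, h⟩ := hF.exists_leaf_eventually hg hgD (hUM hx)
      exact ⟨L, hL, mem_interior_iff_mem_nhds.2 h⟩
  refine ⟨L, hL, ?_⟩
  filter_upwards [hU] with q hq using interior_subset (s := g ⁻¹' L) (hsub hq)

/-- A connected curve that is tangent to the leaves of a foliation of the complement of a set `Z`
and meets `Z` only in isolated points lies in one leaf, up to these points. -/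
theorem IsFoliationOf.exists_leaf_of_isConnected [T1Space N] {Z : Set X}
    (hF : IsFoliationOf m k Zᶜ D F)
    (hg : MDifferentiable 𝓘(ℝ, ℂ) 𝓘(ℝ, E) g)
    (hgD : ∀ q v, mfderiv 𝓘(ℝ, ℂ) 𝓘(ℝ, E) g q v ∈ D (g q)) {K : Set N} (hK : IsConnected K)
    (hZ : ∀ p ∈ K, ∀ᶠ q in 𝓝[≠] p, g q ∉ Z) :
    ∃ L ∈ F, ∀ p ∈ K, g p ∉ Z → g p ∈ L := by
  have hne := nhdsNE_neBot_of_chartedSpace_complex (N := N)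
  -- Punctured neighbourhoods attach a leaf also to the points mapped into Z, so these open sets
  -- cover all of K.
  obtain ⟨L, hL, hsub⟩ := hK.isPreconnected.exists_subset_of_pairwise_disjoint
    (A := fun L => {p | ∀ᶠ q in 𝓝[≠] p, g q ∈ L})
    (fun L _ => isOpen_setOf_eventually_nhdsNE _)
    (fun L hL L' hL' p hp hp' => by
      have h1 : ∀ᶠ q in 𝓝[≠] p, g q ∈ L := hp
      have h2 : ∀ᶠ q in 𝓝[≠] p, g q ∈ L' := hp'
      obtain ⟨q, hq, hq'⟩ := (h1.and h2).exists
      exact hF.eq_of_mem hL hL' hq hq')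
    hK.nonempty fun p hp => hF.exists_leaf_eventually_nhdsNE hg hgD (hZ p hp)
  refine ⟨L, hL, fun p hp hpZ => ?_⟩
  -- Off Z a full neighbourhood of p maps into some leaf L'; it meets the punctured one mapped into
  -- L, which forces L' = L.
  obtain ⟨L', hL', h⟩ := hF.exists_leaf_eventually hg hgD hpZ
  have hpL : ∀ᶠ q in 𝓝[≠] p, g q ∈ L := hsub hp
  obtain ⟨q, hq, hq'⟩ := (hpL.and (h.filter_mono nhdsWithin_le_nhds)).exists
  rw [hF.eq_of_mem hL hL' hq hq']
  exact h.self_of_nhds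

end TangentCurves

/-! ### Zeros of a holomorphic 2-form along a curve. -/

section ZerosAlongCurves

open Metric Set Filter
open scoped Topology

variable {E : Type*} [NormedAddCommGroup E] [NormedSpace ℂ E]
  {X : Type*} [TopologicalSpace X] [ChartedSpace E X] [IsManifold 𝓘(ℂ, E) ω X]
  {N : Type*} [TopologicalSpace N] [ChartedSpace ℂ N] [IsManifold 𝓘(ℂ, ℂ) ω N]

/-- The zeros of a holomorphic 2-form along a holomorphic curve are isolated, unless it vanishes
identically near the given point of the curve. -/
theorem HolomorphicTwoForm.eventually_mem_zeroLocus_or (α : HolomorphicTwoForm E X) {g : N → X}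
    (hg : ContMDiff 𝓘(ℂ, ℂ) 𝓘(ℂ, E) ω g) (p : N) :
    (∀ᶠ q in 𝓝 p, g q ∈ α.zeroLocus) ∨ ∀ᶠ q in 𝓝[≠] p, g q ∉ α.zeroLocus := by
  set c := chartAt ℂ p with hc
  set e := chartAt E (g p) with he
  have heA : e ∈ atlas E X := chart_mem_atlas E (g p)
  have hp : p ∈ c.source := mem_chart_source ℂ p
  have hgp : g p ∈ e.source := mem_chart_source E (g p)
  set W : Set ℂ := c.target ∩ c.symm ⁻¹' (g ⁻¹' e.source) with hW
  have hWo : IsOpen W := c.continuousOn_symm.isOpen_inter_preimage c.open_target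
    (e.open_source.preimage hg.continuous)
  have hpW : c p ∈ W := by
    refine ⟨c.map_source hp, ?_⟩
    rwa [mem_preimage, mem_preimage, c.left_inv hp]
  have hsm : ContMDiffOn 𝓘(ℂ, ℂ) 𝓘(ℂ, E) ω (e ∘ g ∘ c.symm) W := by
    have h1 : ContMDiffOn 𝓘(ℂ, ℂ) 𝓘(ℂ, ℂ) ω c.symm c.target := contMDiffOn_chart_symm
    have h2 : ContMDiffOn 𝓘(ℂ, E) 𝓘(ℂ, E) ω e e.source := contMDiffOn_chart
    exact h2.comp (hg.comp_contMDiffOn (h1.mono inter_subset_left)) fun z hz => hz.2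
  have hdiff : DifferentiableOn ℂ (fun z => chartForm α.form e (e (g (c.symm z)))) W :=
    (α.holomorphic e heA).comp (hsm.contDiffOn.differentiableOn (by simp))
      fun z hz => e.map_source hz.2
  have hiff : ∀ q ∈ c.source, g q ∈ e.source →
      (chartForm α.form e (e (g (c.symm (c q)))) = 0 ↔ g q ∈ α.zeroLocus) := by
    intro q hq hgq
    rw [c.left_inv hq]
    exact chartForm_eq_zero_iff α heA hgq
  have hnear : ∀ᶠ q in 𝓝 p, q ∈ c.source ∧ g q ∈ e.source :=
    (c.open_source.eventually_mem hp).and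
      (hg.continuous.continuousAt.eventually (e.open_source.mem_nhds hgp))
  -- The identity theorem in one complex variable, for a function with values in the space of
  -- 2-forms on E.
  rcases (hdiff.analyticAt (hWo.mem_nhds hpW)).eventually_eq_zero_or_eventually_ne_zero with h | h
  · left
    filter_upwards [hnear, (c.continuousAt hp).eventually h] with q hq h'
    exact (hiff q hq.1 hq.2).1 h'
  · right
    rw [eventually_nhdsWithin_iff] at h ⊢
    filter_upwards [hnear, (c.continuousAt hp).eventually h] with q hq h' hqp hqZ
    exact h' (fun h'' => hqp (c.injOn hq.1 hp h'')) ((hiff q hq.1 hq.2).2 hqZ)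

end ZerosAlongCurves

/-- Each neighbourhood of a finite subcover contains at most its centre from T. -/
theorem IsCompact.finite_inter_of_eventually_nhdsNE {N : Type*} [TopologicalSpace N] {K T : Set N}
    (hK : IsCompact K) (hT : ∀ p ∈ K, ∀ᶠ q in nhdsWithin p {p}ᶜ, q ∉ T) : (K ∩ T).Finite := by
  obtain ⟨t, -, ht⟩ := hK.elim_nhds_subcover (fun p => {q | q ∈ ({p}ᶜ : Set N) → q ∉ T})
    fun p hp => eventually_nhdsWithin_iff.1 (hT p hp)
  refine t.finite_toSet.subset fun q hq => ?_
  obtain ⟨p, hp, hqp⟩ := Set.mem_iUnion₂.1 (ht hq.1)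
  by_contra hqt
  exact hqp (fun h => hqt (by rwa [Set.mem_singleton_iff.1 h])) hq.2

/-! ### The foliation and the stable maps tangent to it. -/

theorem mainTheorem5
    {E : Type*} [NormedAddCommGroup E] [NormedSpace ℂ E] [FiniteDimensional ℂ E]
    (hE : Module.finrank ℂ E = 3)
    {X : Type*} [TopologicalSpace X] [ChartedSpace E X] [IsManifold 𝓘(ℂ, E) ω X]
    [T2Space X] [CompactSpace X]
    (w : KaehlerForm E X) (α : HolomorphicTwoForm E X) (hα : ∃ x, α.form x ≠ 0) :
    (∃ F : Set (Set X),
      IsFoliationOf 2 4 α.zeroLocusᶜ (fun x => LinearMap.ker (kEndo w α x)) F) ∧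
    ∀ F : Set (Set X),
      IsFoliationOf 2 4 α.zeroLocusᶜ (fun x => LinearMap.ker (kEndo w α x)) F →
      ∀ {N : Type*} [TopologicalSpace N] [ChartedSpace ℂ N] [IsManifold 𝓘(ℂ, ℂ) ω N]
        [T2Space N] [CompactSpace N] {n : ℕ} (C : NodalCurve N n) (f : C.Curve → X),
        C.IsStableMap E f →
        (∃ p q, f p ≠ f q) →
        (∀ (p : N) (v : TangentSpace 𝓘(ℝ, ℂ) p),
          kEndo w α (f (C.proj p)) (mfderiv 𝓘(ℝ, ℂ) 𝓘(ℝ, E) (f ∘ C.proj) p v) = 0) →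
        (∀ A ∈ C.irreducibleComponents,
          f '' A ⊆ α.zeroLocus ∨
          ∃ L ∈ F, ∃ S : Set X, S.Finite ∧ S ⊆ α.zeroLocus ∧ f '' A ⊆ L ∪ S) ∧
        (α.zeroLocus = ∅ → ∃ L ∈ F, Set.range f ⊆ L) := by
  constructor
  · have : ProperSpace E := FiniteDimensional.proper ℂ E
    have : SecondCountableTopology X := ChartedSpace.secondCountable_of_sigmaCompact E X
    refine exists_isFoliationOf fun p hp => ?_
    obtain ⟨φ, hpφ, h1, h2, h3, h4, h5⟩ := exists_flowBox_kEndo hE w α hp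
    exact ⟨φ, hpφ, h1, h2, h3, h4, h5⟩
  intro F hF N _ _ _ _ _ n C f hf _ hK
  have : IsManifold 𝓘(ℝ, ℂ) ∞ N := isManifold_real_of_complex
  have : IsManifold 𝓘(ℝ, ℂ) 1 N := IsManifold.of_le (n := ∞) (by simp)
  have hhol : ContMDiff 𝓘(ℂ, ℂ) 𝓘(ℂ, E) ω (f ∘ C.proj) := hf.holomorphic
  have hg : MDifferentiable 𝓘(ℝ, ℂ) 𝓘(ℝ, E) (f ∘ C.proj) := fun p =>
    (HasMFDerivAt.restrictScalars_real
      ((hhol p).mdifferentiableAt (by simp)).hasMFDerivAt).mdifferentiableAt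
  have hgD : ∀ q v, mfderiv 𝓘(ℝ, ℂ) 𝓘(ℝ, E) (f ∘ C.proj) q v ∈
      LinearMap.ker (kEndo w α ((f ∘ C.proj) q)) := fun q v => LinearMap.mem_ker.2 (hK q v)
  have hne := nhdsNE_neBot_of_chartedSpace_complex (N := N)
  constructor
  · rintro _ ⟨p₀, rfl⟩
    rw [Set.image_image]
    have hconn : IsConnected (connectedComponent p₀) := isConnected_connectedComponent
    -- The points near which α vanishes along the curve, and those with a punctured neighbourhood
    -- free of zeros, form two disjoint open sets covering the component.
    rcases hconn.isPreconnected.subset_or_subset (isOpen_setOfPred_eventually_nhds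
        (p := fun q => (f ∘ C.proj) q ∈ α.zeroLocus))
      (isOpen_setOf_eventually_nhdsNE fun q => (f ∘ C.proj) q ∉ α.zeroLocus)
      (Set.disjoint_left.2 fun p hp hp' => by
        obtain ⟨q, hq, hq'⟩ := ((hp.filter_mono nhdsWithin_le_nhds).and hp').exists
        exact hq' hq)
      (fun p _ => α.eventually_mem_zeroLocus_or hhol p) with h | h
    · left
      rintro _ ⟨p, hp, rfl⟩
      exact (h hp).self_of_nhds
    · right
      obtain ⟨L, hL, hsub⟩ := hF.exists_leaf_of_isConnected hg hgD hconn h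
      -- The exceptional set is the image of the zeros on the component, which are isolated in a
      -- compact set.
      refine ⟨L, hL, (f ∘ C.proj) '' (connectedComponent p₀ ∩ (f ∘ C.proj) ⁻¹' α.zeroLocus),
        (isClosed_connectedComponent.isCompact.finite_inter_of_eventually_nhdsNE h).image _,
        ?_, ?_⟩
      · rintro _ ⟨p, hp, rfl⟩
        exact hp.2
      · rintro _ ⟨p, hp, rfl⟩
        by_cases hpZ : (f ∘ C.proj) p ∈ α.zeroLocus
        · exact Or.inr ⟨p, ⟨hp, hpZ⟩, rfl⟩
        · exact Or.inl (hsub p hp hpZ)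
  · intro hZ
    have := hf.connected
    have hM : ∀ x : X, x ∈ α.zeroLocusᶜ := fun x => by rw [hZ]; exact fun h => h
    have hopen : ∀ L ∈ F, IsOpen (f ⁻¹' L) := fun L hL => by
      -- Openness in the nodal curve is tested on the normalization, so nodes need no separate
      -- treatment.
      refine (isQuotientMap_quotient_mk' (s := C.setoid)).isOpen_preimage.1 ?_
      rw [isOpen_iff_eventually]
      intro q hq
      obtain ⟨L', hL', h⟩ := hF.exists_leaf_eventually hg hgD (hM ((f ∘ C.proj) q))
      rwa [hF.eq_of_mem hL hL' hq h.self_of_nhds]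
    obtain ⟨L, hL, hsub⟩ := (isPreconnected_univ (α := C.Curve)).exists_subset_of_pairwise_disjoint
      (F := F) (A := fun L => f ⁻¹' L) hopen
      (fun L hL L' hL' x hx hx' => hF.eq_of_mem hL hL' hx hx') Set.univ_nonempty
      fun x _ => by
        have h : f x ∈ ⋃₀ F := by rw [hF.sUnion_eq]; exact hM _
        exact h
    exact ⟨L, hL, Set.range_subset_iff.2 fun x => hsub (Set.mem_univ x)⟩
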